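/- Let $X$ be a complex Banach space and let $-A\colon \mathsf D(A)\subseteq X\to X$ be the generator of a strongly measurable semigroup $(S(t))_{t\ge 0}\subset\mathscr L(X)$ ($S(0)=\mathrm{id}_X$, $S(t+r)=S(t)S(r)$) that is uniformly bounded. Here "generator" means that for all $\lambda$ with $\operatorname{Re}\lambda>0$ the operator $\lambda+A\colon\mathsf D(A)\to X$ is bijective with inverse $z\mapsto\int_0^\infty e^{-\lambda t}S(t)z\,dt$; strong continuity at $0$ is not required. For $M_0\ge 1$ and $w\in\mathbb R$ consider the estimate $$\|S(t)\|\le M_0e^{-wt}\quad\text{for all } t\ge 0. \tag{1}$$ Uniform boundedness means that (1) holds for some $M_0\ge 1$, $w\ge 0$; uniform exponential stability means that it holds for some $M_0\ge1$, $w>0$. The semigroup is bounded analytic if $t\mapsto S(t)\in\mathscr L(X)$, $t>0$, has a bounded holomorphic extension to a sector $\{z\neq 0:|\arg z|<\varphi\}$ for some $\varphi\in(0,\pi/2)$. Fractional powers: $A^0=\mathrm{id}_X$; under exponential stability, for $\alpha>0$, $A^{-\alpha}=\frac1{\Gamma(\alpha)}\int_0^\infty\sigma^{\alpha-1}S(\sigma)\,d\sigma$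 and $A^\alpha=(A^{-\alpha})^{-1}$ with domain the range of $A^{-\alpha}$. Incomplete gamma functions: $\overline\Gamma(\alpha,z)=\frac1{\Gamma(\alpha)}\int_z^\infty\zeta^{\alpha-1}e^{-\zeta}\,d\zeta$ for $z\in\mathbb C\setminus(-\infty,0)$ (principal branch). If $f(z)=\int_{[0,\infty)}e^{-zr}\,d\mu(r)$ for $\operatorname{Re}z\ge0$ with a complex Borel measure $\mu$, put $f(A)=\int_{[0,\infty)}S(r)\,d\mu(r)$ (Phillips calculus). Write $\alpha=\lfloor\alpha\rfloor+\{\alpha\}$. For $t>0$ and $\alpha\in(0,\infty)\setminus\mathbb N$ set $$\overline\Gamma(\alpha,tA)x=[z\mapsto\overline\Gamma(\{\alpha\},tz)](A)\,x+\sum_{k=1}^{\lfloor\alpha\rfloor}\frac{t^{k+\{\alpha\}-1}}{\Gamma(k+\{\alpha\})}A^{k+\{\alpha\}-1}S(t)x,\qquad x\in\mathsf D(A^{(\alpha-1)\vee0}).$$ Dirichlet solution: let $t_0\in\mathbb R$, $p\in[1,\infty]$ and let $F$ be $L^p((-\infty,t_0];X)$ or $L^p_{\rm loc}((-\infty,t_0];X)$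 ($p$-integrability on each $[a,t_0]$). Let $\mathfrak I^0=\mathrm{id}$, $\mathfrak I^\alpha v(t)=\frac1{\Gamma(\alpha)}\int_0^\infty\tau^{\alpha-1}S(\tau)v(t-\tau)\,d\tau$ for $\alpha>0$, and for $v\in F$ let $\mathfrak D^\beta v=(\partial_t+A)^{\lceil\beta\rceil}\mathfrak I^{\lceil\beta\rceil-\beta}v$, where $\partial_t+A$ acts on those $v\in F$ which have a weak derivative in $F$, take values in $\mathsf D(A)$ almost everywhere, and satisfy $Av\in F$. For $s\in(0,\infty)\setminus\mathbb N$ and bounded continuous $g\colon(-\infty,t_0]\to X$ such that $\mathfrak D^{(s-1)\vee0}g$ is defined and bounded continuous and $\mathfrak D^{\{s\}+k-1}g$, $1\le k\le\lfloor s\rfloor$, are defined and continuous, the solution $u\colon\mathbb R\to X$ of order $s$ of the Dirichlet problem $\mathfrak D^su=0$ on $(t_0,\infty)$, $u=g$ on $(-\infty,t_0]$ is defined by $u=g$ on $(-\infty,t_0]$ and, for $t>t_0$, $$u(t)=\frac{\sin(\pi\{s\})}{\pi}\int_0^\infty\frac{\tau^{-\{s\}}}{\tau+1}S((t-t_0)(\tau+1))g(t_0-(t-t_0)\tau)\,d\tau+\sum_{k=1}^{\lfloor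 s\rfloor}\frac{(t-t_0)^{\{s\}+k-1}}{\Gamma(\{s\}+k)}S(t-t_0)\,\mathfrak D^{\{s\}+k-1}g(t_0).$$ **Corollary.** Let $s\in(0,\infty)\setminus\mathbb N$, $p\in[1,\infty]$, $t_0\in\mathbb R$, suppose that $s\in(0,1)$ or that the semigroup is uniformly exponentially stable, and let $g\equiv x$ with $x\in\mathsf D(A^{(s-1)\vee 0})$. Then the solution exists for $F=L^p_{\rm loc}$, and for $F=L^p$ if $p=\infty$. For either choice of $F$, whenever the solution $u$ exists, it satisfies, for all $t>t_0$, $S(t-t_0)x\in\mathsf D(A^{\{s\}+k-1})$ for $1\le k\le\lfloor s\rfloor$ and $$u(t)=\overline\Gamma(s,(t-t_0)A)x .$$ If, in addition, $s\in(0,1)$ or the semigroup is bounded analytic, then for all $t>t_0$ $$\|u(t)\|\le\Bigl[M_0\overline\Gamma(\{s\},w(t-t_0))+e^{-w(t-t_0)}\sum_{k=1}^{\lfloor s\rfloor}\frac{M_{\{s\}+k-1}}{\Gamma(\{s\}+k)}\Bigr]\|x\|$$ for all constants $w\ge0$ and $M_0,M_{\{s\}},\dots,M_{s-1}\ge1$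 such that (1) holds and, for each $\beta\in\{\{s\},\{s\}+1,\dots,s-1\}$ (no $\beta$ if $s<1$), $$S(t)X\subseteq\mathsf D(A^\beta)\ \text{ and }\ \|A^\beta S(t)\|\le M_\beta t^{-\beta}e^{-wt}\quad\text{for all } t>0. \tag{2}$$ Such constants exist: if the semigroup is uniformly exponentially stable and bounded analytic and (1) holds with some $M_0$ and $w$, then for each $w'\in[0,w)$ and each $\beta\ge0$ there is $M_\beta\ge1$ such that (2) holds with $w'$ in place of $w$. -/

import Mathlib

open MeasureTheory Set Filter Topology
open scoped ENNReal ContDiff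

noncomputable section

namespace FracParabolic

variable {X : Type*} [NormedAddCommGroup X] [NormedSpace ℂ X]

/-! ### Semigroups and their generators -/

/-- A strongly measurable semigroup `(S(t))_{t ≥ 0}` of bounded operators on `X`.
Only the values `S t` with `0 ≤ t` matter. No strong continuity at `0` is required. -/
structure IsMeasurableSemigroup (S : ℝ → X →L[ℂ] X) : Prop where
  zero : S 0 = ContinuousLinearMap.id ℂ X
  add : ∀ t r : ℝ, 0 ≤ t → 0 ≤ r → S (t + r) = (S t).comp (S r)
  meas : ∀ x : X, AEStronglyMeasurable (fun t => S t x) (volume.restrict (Ioi (0 : ℝ)))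

/-- The estimate `‖S(t)‖ ≤ M₀ e^{-wt}` for all `t ≥ 0`, where `M₀ ≥ 1`. -/
def HasExpBound (S : ℝ → X →L[ℂ] X) (M₀ w : ℝ) : Prop :=
  1 ≤ M₀ ∧ ∀ t : ℝ, 0 ≤ t → ‖S t‖ ≤ M₀ * Real.exp (-(w * t))

/-- Uniform boundedness of the semigroup. -/
def UniformlyBounded (S : ℝ → X →L[ℂ] X) : Prop :=
  ∃ M₀ w : ℝ, 0 ≤ w ∧ HasExpBound S M₀ w

/-- Uniform exponential stability of the semigroup. -/
def UniformlyExpStable (S : ℝ → X →L[ℂ] X) : Prop :=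
  ∃ M₀ w : ℝ, 0 < w ∧ HasExpBound S M₀ w

/-- The open sector of half-angle `φ` around the positive real axis. -/
def sector (φ : ℝ) : Set ℂ := {z : ℂ | z ≠ 0 ∧ |z.arg| < φ}

/-- Bounded analyticity: `(0,∞) ∋ t ↦ S(t)` has a bounded holomorphic extension to a sector. -/
def BoundedAnalytic (S : ℝ → X →L[ℂ] X) : Prop :=
  ∃ φ : ℝ, 0 < φ ∧ φ < Real.pi / 2 ∧ ∃ T : ℂ → X →L[ℂ] X,
    DifferentiableOn ℂ T (sector φ) ∧ (∃ C : ℝ, ∀ z ∈ sector φ, ‖T z‖ ≤ C) ∧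
      ∀ t : ℝ, 0 < t → T (t : ℂ) = S t

/-- `-A` is the generator of the (uniformly bounded, strongly measurable) semigroup `S`: for every
`λ` in the open right half-plane, `λ + A` is a bijection from `D(A)` onto `X` whose inverse is the
Laplace transform `R(λ) z = ∫₀^∞ e^{-λt} S(t) z dt`; that is, `(x, y)` lies in the graph of `A`
if and only if `R(λ)(λ x + y) = x`. -/
def IsNegGenerator (A : X →ₗ.[ℂ] X) (S : ℝ → X →L[ℂ] X) : Prop :=
  ∀ l : ℂ, 0 < l.re → ∀ x y : X,
    (x, y) ∈ A.graph ↔ ∫ t in Ioi (0 : ℝ), Complex.exp (-(l * t)) • S t (l • x + y) = x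

/-! ### Fractional powers -/

/-- For `α > 0`, the set of pairs `(x, y)` with `x = A^{-α} y`, where
`A^{-α} y = Γ(α)⁻¹ ∫₀^∞ σ^{α-1} S(σ) y dσ` (an absolutely convergent integral for every `y` if
the semigroup is uniformly exponentially stable). -/
def negPowGraph (S : ℝ → X →L[ℂ] X) (α : ℝ) : Submodule ℂ (X × X) where
  carrier := {q | IntegrableOn (fun σ : ℝ => σ ^ (α - 1) • S σ q.2) (Ioi 0) ∧
    (Real.Gamma α)⁻¹ • ∫ σ in Ioi (0 : ℝ), σ ^ (α - 1) • S σ q.2 = q.1}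
  zero_mem' := by simp
  add_mem' := by
    rintro ⟨a, b⟩ ⟨c, d⟩ ⟨h1, h2⟩ ⟨h3, h4⟩
    simp only [mem_ofPred_eq, Prod.mk_add_mk, map_add, smul_add] at *
    refine ⟨h1.add h3, ?_⟩
    rw [integral_add h1 h3, smul_add, h2, h4]
  smul_mem' := by
    rintro c ⟨a, b⟩ ⟨h1, h2⟩
    simp only [mem_ofPred_eq, Prod.smul_mk, map_smul] at *
    have h : (fun σ : ℝ => σ ^ (α - 1) • c • S σ b) = fun σ : ℝ => c • σ ^ (α - 1) • S σ b := by
      funext σ; rw [smul_comm]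
    rw [h]
    refine ⟨Integrable.smul c h1, ?_⟩
    rw [integral_smul, smul_comm, h2]

/-- The fractional power `A^α`, `α ≥ 0`, of the negative generator `A` of a uniformly exponentially
stable semigroup `S`: `A^0` is the identity on `X`, and for `α > 0` the operator `A^α` is the
inverse of `A^{-α}`, with domain the range of `A^{-α}`.
(`A^0` makes sense, and is the identity, without exponential stability.) -/
def fracPow (S : ℝ → X →L[ℂ] X) (α : ℝ) : X →ₗ.[ℂ] X :=
  open scoped Classical in
  if α = 0 then LinearMap.id.toPMap ⊤ else (negPowGraph S α).toLinearPMap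

/-- The value `A^α x` for `x ∈ D(A^α)` (and `0` otherwise). -/
def fracPowApply (S : ℝ → X →L[ℂ] X) (α : ℝ) (x : X) : X :=
  open scoped Classical in
  if h : x ∈ (fracPow S α).domain then fracPow S α ⟨x, h⟩ else 0

/-- The estimate `‖A^β S(t)‖ ≤ M t^{-β} e^{-wt}` for all `t > 0`, where `M ≥ 1`; it includes
that `S(t)` maps `X` into `D(A^β)`. -/
def HasAnalyticBound (S : ℝ → X →L[ℂ] X) (β M w : ℝ) : Prop :=
  1 ≤ M ∧ ∀ t : ℝ, 0 < t → ∀ x : X, S t x ∈ (fracPow S β).domain ∧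
    ‖fracPowApply S β (S t x)‖ ≤ M * t ^ (-β) * Real.exp (-(w * t)) * ‖x‖

/-! ### Phillips calculus and incomplete gamma functions -/

/-- `T = f(A)` in the Phillips calculus: `f` is, on the closed right half-plane, the Laplace
transform of a complex Borel measure `μ` of bounded variation on `[0,∞)`, and `T = ∫ S(r) dμ(r)`.
The complex measure is written as `dμ = h dν` with `ν` a finite positive measure on `[0,∞)` and `h`
a `ν`-integrable complex density (every complex measure has this form). -/
def IsPhillips (S : ℝ → X →L[ℂ] X) (f : ℂ → ℂ) (T : X →L[ℂ] X) : Prop :=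
  ∃ (ν : Measure ℝ) (h : ℝ → ℂ), IsFiniteMeasure ν ∧ ν (Iio 0) = 0 ∧ Integrable h ν ∧
    (∀ z : ℂ, 0 ≤ z.re → f z = ∫ r, Complex.exp (-(z * r)) * h r ∂ν) ∧
    ∀ x : X, Integrable (fun r => h r • S r x) ν ∧ T x = ∫ r, h r • S r x ∂ν

/-- The operator `f(A)` of the Phillips calculus (`0` if `f` is not in its domain). -/
def phillips (S : ℝ → X →L[ℂ] X) (f : ℂ → ℂ) : X →L[ℂ] X :=
  open scoped Classical in
  if h : ∃ T, IsPhillips S f T then h.choose else 0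

/-- The normalized upper incomplete gamma function
`Γ(α)⁻¹ ∫_z^∞ ζ^{α-1} e^{-ζ} dζ` (principal branch), integrated along the horizontal ray
`ζ = z + r`, `r > 0`, which avoids `(-∞, 0)` whenever `z` does. -/
def incGamma (α : ℝ) (z : ℂ) : ℂ :=
  ((Real.Gamma α : ℝ) : ℂ)⁻¹ *
    ∫ r in Ioi (0 : ℝ), (z + r) ^ ((α : ℂ) - 1) * Complex.exp (-(z + r))

/-- The operator-valued incomplete gamma function `Γ̄(α, tA) x`, for `t > 0`, `α > 0` not an integer
and `x ∈ D(A^{(α-1) ∨ 0})`. For `α ∈ (0,1)` the sum is empty and this is the operator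
`[z ↦ Γ̄(α, tz)](A)` of the Phillips calculus. -/
def incGammaOp (S : ℝ → X →L[ℂ] X) (α t : ℝ) (x : X) : X :=
  phillips S (fun z => incGamma (Int.fract α) (t * z)) x +
    ∑ k ∈ Finset.Icc 1 ⌊α⌋₊,
      (t ^ ((k : ℝ) + Int.fract α - 1) / Real.Gamma ((k : ℝ) + Int.fract α)) •
        fracPowApply S ((k : ℝ) + Int.fract α - 1) (S t x)

/-! ### Fractional parabolic derivatives on `(-∞, t₀]`

Functions on `(-∞, t₀]` are represented by functions on `ℝ` of which only the restriction to
`(-∞, t₀]` matters. `F` stands for one of the two function spaces `HalfLp`, `HalfLpLoc`. -/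

/-- Membership in `L^p((-∞, t₀]; X)`. -/
def HalfLp (p : ℝ≥0∞) (t₀ : ℝ) (u : ℝ → X) : Prop :=
  MemLp u p (volume.restrict (Iic t₀))

/-- Membership in `L^p_loc((-∞, t₀]; X)`: `p`-integrability on all intervals `[a, t₀]`. -/
def HalfLpLoc (p : ℝ≥0∞) (t₀ : ℝ) (u : ℝ → X) : Prop :=
  ∀ a : ℝ, MemLp u p (volume.restrict (Icc a t₀))

/-- `du` is the weak derivative of `u` on `(-∞, t₀)`. -/
def IsWeakDeriv (t₀ : ℝ) (u du : ℝ → X) : Prop :=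
  ∀ φ : ℝ → ℝ, ContDiff ℝ ∞ φ → HasCompactSupport φ → tsupport φ ⊆ Iio t₀ →
    ∫ t in Iio t₀, deriv φ t • u t = -∫ t in Iio t₀, φ t • du t

/-- `u ∈ D(∂ₜ + A)` and `v = (∂ₜ + A) u` almost everywhere on `(-∞, t₀]`: the function `u` lies
in `F` with weak derivative in `F`, takes values in `D(A)` almost everywhere, and `A u(·)` is
in `F`. -/
def IsParabolic (A : X →ₗ.[ℂ] X) (F : (ℝ → X) → Prop) (t₀ : ℝ) (u v : ℝ → X) : Prop :=
  F u ∧ ∃ du au : ℝ → X, F du ∧ F au ∧ IsWeakDeriv t₀ u du ∧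
    (∀ᵐ t ∂volume.restrict (Iic t₀), (u t, au t) ∈ A.graph) ∧
    ∀ᵐ t ∂volume.restrict (Iic t₀), v t = du t + au t

/-- `u ∈ D((∂ₜ + A)^n)` and `v = (∂ₜ + A)^n u` almost everywhere on `(-∞, t₀]`. -/
def IsParabolicIter (A : X →ₗ.[ℂ] X) (F : (ℝ → X) → Prop) (t₀ : ℝ) (n : ℕ) (u v : ℝ → X) : Prop :=
  ∃ U : ℕ → ℝ → X, F (U 0) ∧ U 0 =ᵐ[volume.restrict (Iic t₀)] u ∧
    (∀ j < n, IsParabolic A F t₀ (U j) (U (j + 1))) ∧ U n =ᵐ[volume.restrict (Iic t₀)] v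

/-- The integral `𝔍^α u(t) = Γ(α)⁻¹ ∫₀^∞ τ^{α-1} S(τ) u(t-τ) dτ`, with `𝔍^0 = id`. -/
def fracInt (S : ℝ → X →L[ℂ] X) (α : ℝ) (u : ℝ → X) (t : ℝ) : X :=
  open scoped Classical in
  if α = 0 then u t
  else (Real.Gamma α)⁻¹ • ∫ τ in Ioi (0 : ℝ), τ ^ (α - 1) • S τ (u (t - τ))

/-- `𝔍^α u` is defined: the defining integral converges for almost every `t ≤ t₀`. -/
def FracIntConverges (S : ℝ → X →L[ℂ] X) (α : ℝ) (t₀ : ℝ) (u : ℝ → X) : Prop :=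
  α = 0 ∨ ∀ᵐ t ∂volume.restrict (Iic t₀),
    IntegrableOn (fun τ : ℝ => τ ^ (α - 1) • S τ (u (t - τ))) (Ioi 0)

/-- `u ∈ D(𝔇^β)` and `v = 𝔇^β u` almost everywhere on `(-∞, t₀]`, where
`𝔇^β = (∂ₜ + A)^⌈β⌉ 𝔍^{⌈β⌉ - β}`. -/
def IsFracDeriv (A : X →ₗ.[ℂ] X) (S : ℝ → X →L[ℂ] X) (F : (ℝ → X) → Prop) (t₀ β : ℝ)
    (u v : ℝ → X) : Prop :=
  F u ∧ FracIntConverges S ((⌈β⌉₊ : ℝ) - β) t₀ u ∧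
    IsParabolicIter A F t₀ ⌈β⌉₊ (fracInt S ((⌈β⌉₊ : ℝ) - β) u) v

/-- `v` is bounded and continuous on `(-∞, t₀]`. -/
def HalfCb (t₀ : ℝ) (v : ℝ → X) : Prop :=
  ContinuousOn v (Iic t₀) ∧ ∃ C : ℝ, ∀ t ≤ t₀, ‖v t‖ ≤ C

/-! ### The solution of the Dirichlet problem -/

/-- `u` is the solution of order `s` to the Dirichlet problem `𝔇^s u = 0` on `(t₀, ∞)`, `u = g` on
`(-∞, t₀]`. The conditions on the datum `g` are part of the definition. The values
`𝔇^{{s}+k-1} g(t₀)` are those of the continuous representatives `D k`. -/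
structure IsDirichletSolution (A : X →ₗ.[ℂ] X) (S : ℝ → X →L[ℂ] X) (F : (ℝ → X) → Prop)
    (s t₀ : ℝ) (g u : ℝ → X) : Prop where
  datum_Cb : HalfCb t₀ g
  datum_dom : ∃ v : ℝ → X, IsFracDeriv A S F t₀ (max (s - 1) 0) g v ∧ HalfCb t₀ v
  eq_datum : ∀ t ≤ t₀, u t = g t
  eq_formula : ∃ D : ℕ → ℝ → X,
    (∀ k ∈ Finset.Icc 1 ⌊s⌋₊,
      IsFracDeriv A S F t₀ (Int.fract s + k - 1) g (D k) ∧ ContinuousOn (D k) (Iic t₀)) ∧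
    ∀ t : ℝ, t₀ < t →
      IntegrableOn (fun τ : ℝ => (τ ^ (-Int.fract s) / (τ + 1)) •
        S ((t - t₀) * (τ + 1)) (g (t₀ - (t - t₀) * τ))) (Ioi 0) ∧
      u t = (Real.sin (Real.pi * Int.fract s) / Real.pi) •
          (∫ τ in Ioi (0 : ℝ), (τ ^ (-Int.fract s) / (τ + 1)) •
            S ((t - t₀) * (τ + 1)) (g (t₀ - (t - t₀) * τ))) +
        ∑ k ∈ Finset.Icc 1 ⌊s⌋₊,
          ((t - t₀) ^ (Int.fract s + k - 1) / Real.Gamma (Int.fract s + k)) •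
            S (t - t₀) (D k t₀)

end FracParabolic

end

namespace FracParabolic

variable {X : Type*} [NormedAddCommGroup X] [NormedSpace ℂ X]

/-! For a constant datum the parabolic calculus collapses to fractional powers: `∂ₜ + A` acts as
`A`, and `𝔍^α` acts as `A^{-α}`. Hence `𝔇^β x` is the constant `A^β x`. Since `S(t)` commutes with
these powers, the sum in the solution formula is the sum in `Γ̄(s, tA)x`. The ingredients are the
index law `negPow_negPow`, the injectivity `negPow_eq_zero` and the uniqueness statement
`IsFracDeriv.ae_eq_of_const`.

The integral term comes from the scalar identity `incGamma_eq_integral`: for `0 < α < 1`, `Γ̄(α, z)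
= sin(πα)/π ∫₀^∞ τ^{-α}/(τ+1) e^{-z(τ+1)} dτ` on the closed right half-plane. So `Γ̄(α, t·)` is the
Laplace transform of a positive finite measure, and replacing `e^{-zr}` by `S(r)` yields exactly the
integral in the solution formula. Uniqueness of the representing measure (`IsPhillips.unique`) makes
the Phillips operator well defined.

Positivity of that measure also gives the norm bound: inserting `‖S(r)‖ ≤ M₀ e^{-wr}` turns the
integral back into `Γ̄({s}, wt)`. In the sum the factor `t^{-β}` of the analytic estimate cancels
the power of `t`.

The constants of the analytic estimate come from Cauchy's bound `‖S'(t)‖ ≤ C/t`, from `A^n S(t) =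
(-S'(t/n))^n`, and from `A^β S(t) = A^{-(n-β)} A^n S(t)`. -/

/-! ### Integrals of scalar kernels against the semigroup. -/

theorem IsMeasurableSemigroup.commute {S : ℝ → X →L[ℂ] X} (hS : IsMeasurableSemigroup S)
    {t r : ℝ} (ht : 0 ≤ t) (hr : 0 ≤ r) (y : X) : S t (S r y) = S r (S t y) := by
  rw [← ContinuousLinearMap.comp_apply, ← hS.add t r ht hr, add_comm, hS.add r t hr ht,
    ContinuousLinearMap.comp_apply]

/-- Kernels are extended by zero to the whole line, so that whole-line convolution results apply and
the uncontrolled values of `S` at negative times never enter. -/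
theorem IsMeasurableSemigroup.integrable_smul {S : ℝ → X →L[ℂ] X} (hS : IsMeasurableSemigroup S)
    {M w : ℝ} (hB : HasExpBound S M w) {f : ℝ → ℝ} (hf0 : ∀ t ≤ 0, f t = 0)
    (hf : Integrable (fun t => f t * Real.exp (-(w * t)))) (y : X) :
    Integrable (fun t => f t • S t y) := by
  have hfm : AEStronglyMeasurable f := by
    have h : AEStronglyMeasurable
        (fun t => (f t * Real.exp (-(w * t))) * Real.exp (w * t)) volume :=
      hf.aestronglyMeasurable.mul (by fun_prop)
    refine h.congr (ae_of_all _ fun t => ?_)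
    simp only
    rw [mul_assoc, ← Real.exp_add]; simp
  have hind : (fun t => f t • S t y) = indicator (Ioi 0) (fun t => f t • S t y) := by
    funext t
    by_cases ht : 0 < t
    · rw [indicator_of_mem (by exact ht)]
    · rw [indicator_of_notMem (by exact ht), hf0 t (not_lt.1 ht), zero_smul]
  have hm : AEStronglyMeasurable (fun t => f t • S t y) := by
    rw [hind, aestronglyMeasurable_indicator_iff measurableSet_Ioi]
    exact hfm.restrict.smul (hS.meas y)
  refine (hf.norm.mul_const (M * ‖y‖)).mono' hm (ae_of_all _ fun t => ?_)
  by_cases ht : 0 < t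
  · rw [norm_smul, norm_mul, Real.norm_of_nonneg (Real.exp_pos _).le]
    have := (S t).le_of_opNorm_le (hB.2 t ht.le) y
    calc ‖f t‖ * ‖S t y‖ ≤ ‖f t‖ * (M * Real.exp (-(w * t)) * ‖y‖) := by gcongr
      _ = _ := by ring
  · have hM := hB.1
    rw [hf0 t (not_lt.1 ht)]; simp

/-- Fubini together with `S(t) S(r-t) = S(r)`. This one identity yields both the index law for
negative powers and the resolvent identity linking `A^{-1}` to the generator. -/
theorem IsMeasurableSemigroup.integral_conv [CompleteSpace X]
    {S : ℝ → X →L[ℂ] X} (hS : IsMeasurableSemigroup S)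
    {M w : ℝ} (hB : HasExpBound S M w) {f g : ℝ → ℝ} (hf0 : ∀ t ≤ 0, f t = 0)
    (hg0 : ∀ t ≤ 0, g t = 0)
    (hf : Integrable (fun t => f t * Real.exp (-(w * t))))
    (hg : Integrable (fun t => g t * Real.exp (-(w * t)))) (y : X) :
    ∫ t, f t • S t (∫ r, g r • S r y) = ∫ r, (∫ t, f t * g (r - t)) • S r y := by
  have hP := hf.convolution_integrand (ContinuousLinearMap.mul ℝ ℝ) hg
  have hG : Integrable (fun q : ℝ × ℝ => (f q.2 * g (q.1 - q.2)) • S q.1 y)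
      (volume.prod volume) := by
    have hm : AEStronglyMeasurable
        (fun r : ℝ => indicator (Ioi 0) (fun r => Real.exp (w * r) • S r y) r) := by
      rw [aestronglyMeasurable_indicator_iff measurableSet_Ioi]
      exact AEStronglyMeasurable.smul (𝕜 := ℝ) (by fun_prop) (hS.meas y)
    -- The weights `e^{-wt}` and `e^{-w(r-t)}` multiply to `e^{-wr}`. The compensating factor
    -- `e^{wr}` goes to `S(r)y`, which it keeps bounded by `M‖y‖`. For `r ≤ 0` both sides vanish,
    -- because `t` or `r - t` is nonpositive.
    have heq : (fun q : ℝ × ℝ => (f q.2 * g (q.1 - q.2)) • S q.1 y) =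
        fun q : ℝ × ℝ => (ContinuousLinearMap.mul ℝ ℝ (f q.2 * Real.exp (-(w * q.2)))
          (g (q.1 - q.2) * Real.exp (-(w * (q.1 - q.2))))) •
            indicator (Ioi 0) (fun r => Real.exp (w * r) • S r y) q.1 := by
      funext ⟨r, t⟩
      simp only [ContinuousLinearMap.mul_apply']
      by_cases hr : 0 < r
      · rw [indicator_of_mem (by exact hr), smul_smul]
        congr 1
        have : Real.exp (-(w * t)) * Real.exp (-(w * (r - t))) * Real.exp (w * r) = 1 := by
          rw [← Real.exp_add, ← Real.exp_add]; ring_nf; simp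
        linear_combination (-(f t * g (r - t))) * this
      · rw [indicator_of_notMem (by exact hr), smul_zero]
        rcases le_or_gt t 0 with ht | ht
        · rw [hf0 t ht]; simp
        · rw [hg0 (r - t) (by linarith)]; simp
    rw [heq]
    refine (hP.norm.mul_const (M * ‖y‖)).mono' (hP.aestronglyMeasurable.smul hm.comp_fst)
      (ae_of_all _ fun q => ?_)
    rw [norm_smul]
    refine mul_le_mul_of_nonneg_left ?_ (norm_nonneg _)
    have hM := hB.1
    by_cases hr : 0 < q.1
    · rw [indicator_of_mem (by exact hr), norm_smul, Real.norm_of_nonneg (Real.exp_pos _).le]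
      have := (S q.1).le_of_opNorm_le (hB.2 q.1 hr.le) y
      calc Real.exp (w * q.1) * ‖S q.1 y‖
          ≤ Real.exp (w * q.1) * (M * Real.exp (-(w * q.1)) * ‖y‖) := by gcongr
        _ = (Real.exp (w * q.1) * Real.exp (-(w * q.1))) * (M * ‖y‖) := by ring
        _ = M * ‖y‖ := by rw [← Real.exp_add]; simp
    · rw [indicator_of_notMem (by exact hr), norm_zero]; positivity
  have hstep : ∀ t, f t • S t (∫ r, g r • S r y) = ∫ r, (f t * g (r - t)) • S r y := by
    intro t
    rcases le_or_gt t 0 with ht | ht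
    · simp [hf0 t ht]
    · rw [← ContinuousLinearMap.integral_comp_comm _ (hS.integrable_smul hB hg0 hg y)]
      simp_rw [mul_smul]
      rw [integral_smul, ← integral_sub_right_eq_self _ t]
      congr 2
      funext r
      rw [ContinuousLinearMap.map_smul_of_tower]
      rcases le_or_gt (r - t) 0 with hr | hr
      · simp [hg0 _ hr]
      · rw [← ContinuousLinearMap.comp_apply, ← hS.add t (r - t) ht.le hr.le, add_sub_cancel]
  simp_rw [hstep]
  rw [integral_integral_swap (f := fun t r => (f t * g (r - t)) • S r y) hG.swap]
  simp_rw [integral_smul_const]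

/-! ### Negative powers and the index law. -/

/-- The negative power `A^{-α}`, as a function. -/
noncomputable def negPow (S : ℝ → X →L[ℂ] X) (α : ℝ) (y : X) : X :=
  fracInt S α (fun _ => y) 0

theorem negPow_zero (S : ℝ → X →L[ℂ] X) (y : X) : negPow S 0 y = y := by
  simp [negPow, fracInt]

/-- The kernel `t_+^{α-1}`. -/
noncomputable def powKernel (α t : ℝ) : ℝ := indicator (Ioi 0) (fun t => t ^ (α - 1)) t

theorem powKernel_of_nonpos (α : ℝ) : ∀ t ≤ 0, powKernel α t = 0 := fun _ ht =>
  indicator_of_notMem (not_lt.2 ht) _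

theorem powKernel_of_pos (α : ℝ) {t : ℝ} (ht : 0 < t) : powKernel α t = t ^ (α - 1) :=
  indicator_of_mem (s := Ioi 0) ht _

theorem powKernel_integrable {α w : ℝ} (hα : 0 < α) (hw : 0 < w) :
    Integrable (fun t => powKernel α t * Real.exp (-(w * t))) := by
  have h := integrableOn_rpow_mul_exp_neg_mul_rpow (s := α - 1) (p := 1) (by linarith)
    one_pos hw
  rw [← integrable_indicator_iff measurableSet_Ioi] at h
  refine h.congr (ae_of_all _ fun t => ?_)
  by_cases ht : 0 < t
  · simp [powKernel, ht]
  · simp [powKernel, ht]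

theorem powKernel_smul (S : ℝ → X →L[ℂ] X) (α : ℝ) (y : X) :
    (fun t => powKernel α t • S t y) = indicator (Ioi 0) (fun t => t ^ (α - 1) • S t y) := by
  funext t
  by_cases ht : 0 < t
  · simp [powKernel, ht]
  · simp [powKernel, ht]

theorem negPow_of_pos {S : ℝ → X →L[ℂ] X} {α : ℝ} (hα : 0 < α) (y : X) :
    negPow S α y = (Real.Gamma α)⁻¹ • ∫ t, powKernel α t • S t y := by
  rw [powKernel_smul, integral_indicator measurableSet_Ioi, negPow, fracInt, if_neg hα.ne']

theorem negPow_integrableOn {S : ℝ → X →L[ℂ] X} (hS : IsMeasurableSemigroup S)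
    {M w : ℝ} (hB : HasExpBound S M w) (hw : 0 < w) {α : ℝ} (hα : 0 < α) (y : X) :
    IntegrableOn (fun t => t ^ (α - 1) • S t y) (Ioi 0) := by
  rw [← integrable_indicator_iff measurableSet_Ioi, ← powKernel_smul]
  exact hS.integrable_smul hB (powKernel_of_nonpos α) (powKernel_integrable hα hw) y

/-- The rescaled Beta integral; this is the index law at the level of kernels. -/
theorem powKernel_conv {α β : ℝ} (hα : 0 < α) (hβ : 0 < β) (r : ℝ) :
    ∫ t, powKernel α t * powKernel β (r - t) =
      Real.Gamma α * Real.Gamma β / Real.Gamma (α + β) * powKernel (α + β) r := by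
  rcases le_or_gt r 0 with hr | hr
  · rw [powKernel_of_nonpos _ r hr, mul_zero]
    refine integral_eq_zero_of_ae (ae_of_all _ fun t => ?_)
    rcases le_or_gt t 0 with ht | ht
    · simp [powKernel_of_nonpos _ t ht]
    · simp [powKernel_of_nonpos _ (r - t) (by linarith)]
  have h1 : (fun t => powKernel α t * powKernel β (r - t)) =
      indicator (Ioo 0 r) (fun t => t ^ (α - 1) * (r - t) ^ (β - 1)) := by
    funext t
    by_cases ht : t ∈ Ioo 0 r
    · rw [indicator_of_mem ht, powKernel_of_pos _ ht.1, powKernel_of_pos _ (sub_pos.2 ht.2)]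
    · rw [indicator_of_notMem ht]
      rcases le_or_gt t 0 with h | h
      · simp [powKernel_of_nonpos _ t h]
      · simp [powKernel_of_nonpos _ (r - t) (sub_nonpos.2 (not_lt.1 fun h' => ht ⟨h, h'⟩))]
  rw [h1, integral_indicator measurableSet_Ioo, ← integral_Ioc_eq_integral_Ioo,
    ← intervalIntegral.integral_of_le hr.le, powKernel_of_pos _ hr]
  have h2 := Complex.betaIntegral_scaled α β hr
  rw [Complex.betaIntegral_eq_Gamma_mul_div _ _ (by simpa) (by simpa)] at h2
  have h3 : ∫ x in (0 : ℝ)..r, (x : ℂ) ^ ((α : ℂ) - 1) * ((r : ℂ) - x) ^ ((β : ℂ) - 1) =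
      ((∫ x in (0 : ℝ)..r, x ^ (α - 1) * (r - x) ^ (β - 1) : ℝ) : ℂ) := by
    rw [← intervalIntegral.integral_ofReal]
    refine intervalIntegral.integral_congr fun x hx => ?_
    rw [uIcc_of_le hr.le] at hx
    rw [Complex.ofReal_mul, Complex.ofReal_cpow hx.1, Complex.ofReal_cpow (sub_nonneg.2 hx.2)]
    push_cast; rfl
  rw [h3] at h2
  have h4 : ((r : ℂ) ^ ((α : ℂ) + β - 1)) = ((r ^ (α + β - 1) : ℝ) : ℂ) := by
    rw [Complex.ofReal_cpow hr.le]; push_cast; rfl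
  rw [h4, ← Complex.ofReal_add, Complex.Gamma_ofReal, Complex.Gamma_ofReal,
    Complex.Gamma_ofReal] at h2
  have h5 : ∫ x in (0 : ℝ)..r, x ^ (α - 1) * (r - x) ^ (β - 1) =
      r ^ (α + β - 1) * (Real.Gamma α * Real.Gamma β / Real.Gamma (α + β)) := by
    exact_mod_cast h2
  rw [h5, mul_comm]

variable {S : ℝ → X →L[ℂ] X} {M w : ℝ}

theorem negPow_negPow [CompleteSpace X] (hS : IsMeasurableSemigroup S)
    (hB : HasExpBound S M w) (hw : 0 < w)
    {α β : ℝ} (hα : 0 ≤ α) (hβ : 0 ≤ β) (y : X) :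
    negPow S α (negPow S β y) = negPow S (α + β) y := by
  rcases hα.eq_or_lt with rfl | hα
  · rw [negPow_zero, zero_add]
  rcases hβ.eq_or_lt with rfl | hβ
  · rw [negPow_zero, add_zero]
  have hc := hS.integral_conv hB (powKernel_of_nonpos α) (powKernel_of_nonpos β)
    (powKernel_integrable hα hw) (powKernel_integrable hβ hw) y
  simp_rw [powKernel_conv hα hβ, mul_smul, integral_smul] at hc
  rw [negPow_of_pos hα, negPow_of_pos hβ, negPow_of_pos (add_pos hα hβ)]
  simp_rw [ContinuousLinearMap.map_smul_of_tower, smul_comm _ (Real.Gamma β)⁻¹, integral_smul, hc,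
    smul_smul]
  congr 1
  have := (Real.Gamma_pos_of_pos hα).ne'
  have := (Real.Gamma_pos_of_pos hβ).ne'
  field_simp

/-- Bounded operators that commute with the semigroup commute with the negative powers. -/
theorem map_negPow [CompleteSpace X] (hS : IsMeasurableSemigroup S)
    (hB : HasExpBound S M w) (hw : 0 < w)
    {α : ℝ} (hα : 0 ≤ α) (B : X →L[ℂ] X) (hcomm : ∀ t > 0, ∀ y, B (S t y) = S t (B y)) (y : X) :
    B (negPow S α y) = negPow S α (B y) := by
  rcases hα.eq_or_lt with rfl | hα
  · rw [negPow_zero, negPow_zero]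
  rw [negPow, fracInt, if_neg hα.ne', negPow, fracInt, if_neg hα.ne',
    ContinuousLinearMap.map_smul_of_tower,
    ← ContinuousLinearMap.integral_comp_comm _ (negPow_integrableOn hS hB hw hα y)]
  congr 1
  refine setIntegral_congr_fun measurableSet_Ioi fun t ht => ?_
  rw [ContinuousLinearMap.map_smul_of_tower, hcomm t ht]

theorem semigroup_negPow [CompleteSpace X] (hS : IsMeasurableSemigroup S)
    (hB : HasExpBound S M w) (hw : 0 < w)
    {α : ℝ} (hα : 0 ≤ α) {t : ℝ} (ht : 0 ≤ t) (y : X) :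
    S t (negPow S α y) = negPow S α (S t y) :=
  map_negPow hS hB hw hα (S t) (fun _ hr z => hS.commute ht (le_of_lt hr) z) y

/-! ### Negative powers, the generator and injectivity. -/

/-- By the description of the generator at `λ = 1`, the claim is `R(1)(A^{-1}z + z) = A^{-1}z`, that
is, `R(1)A^{-1} = A^{-1} - R(1)`. -/
theorem negPow_one_mem_graph [CompleteSpace X] (hS : IsMeasurableSemigroup S)
    (hB : HasExpBound S M w) (hw : 0 < w)
    {A : X →ₗ.[ℂ] X} (hA : IsNegGenerator A S) (z : X) : (negPow S 1 z, z) ∈ A.graph := by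
  rw [hA 1 (by simp)]
  set e : ℝ → ℝ := fun t => powKernel 1 t * Real.exp (-t) with he
  have he0 : ∀ t ≤ 0, e t = 0 := fun t ht => by simp [he, powKernel_of_nonpos 1 t ht]
  have hei : Integrable (fun t => e t * Real.exp (-(w * t))) := by
    refine (powKernel_integrable (w := w + 1) one_pos (by linarith)).congr
      (ae_of_all _ fun t => ?_)
    simp only [he]
    rw [mul_assoc, ← Real.exp_add]; ring_nf
  have hI : ∀ y, ∫ t in Ioi (0 : ℝ), Complex.exp (-(1 * t)) • S t y = ∫ t, e t • S t y := by
    intro y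
    rw [← integral_indicator measurableSet_Ioi]
    congr 1
    funext t
    by_cases ht : 0 < t
    · rw [indicator_of_mem (by exact ht), he]
      simp only [powKernel_of_pos 1 ht, sub_self, Real.rpow_zero, one_mul]
      rw [← Complex.ofReal_neg, ← Complex.ofReal_exp, Complex.coe_smul]
    · rw [indicator_of_notMem (by exact ht), he0 t (not_lt.1 ht), zero_smul]
  have hk := powKernel_integrable (w := w) one_pos hw
  -- On `r > 0` this reads `∫₀^r e^{-t} dt = 1 - e^{-r}`, the resolvent identity for kernels.
  have hconv : ∀ r, ∫ t, e t * powKernel 1 (r - t) = powKernel 1 r - e r := by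
    intro r
    rcases le_or_gt r 0 with hr | hr
    · rw [powKernel_of_nonpos _ r hr, he0 r hr, sub_zero]
      refine integral_eq_zero_of_ae (ae_of_all _ fun t => ?_)
      rcases le_or_gt t 0 with ht | ht
      · simp [he0 t ht]
      · simp [powKernel_of_nonpos _ (r - t) (by linarith)]
    · have h1 : (fun t => e t * powKernel 1 (r - t)) =
          indicator (Ioo 0 r) (fun t => Real.exp (-t)) := by
        funext t
        by_cases ht : t ∈ Ioo 0 r
        · rw [indicator_of_mem ht, he]
          simp only
          rw [powKernel_of_pos _ ht.1, powKernel_of_pos _ (sub_pos.2 ht.2)]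
          simp
        · rw [indicator_of_notMem ht]
          rcases le_or_gt t 0 with h | h
          · simp [he0 t h]
          · simp [powKernel_of_nonpos _ (r - t) (sub_nonpos.2 (not_lt.1 fun h' => ht ⟨h, h'⟩))]
      rw [h1, integral_indicator measurableSet_Ioo, ← integral_Ioc_eq_integral_Ioo,
        ← intervalIntegral.integral_of_le hr.le, he]
      simp [powKernel_of_pos _ hr]
  have hc := hS.integral_conv hB he0 (powKernel_of_nonpos 1) hei hk z
  simp_rw [hconv, sub_smul] at hc
  rw [integral_sub (hS.integrable_smul hB (powKernel_of_nonpos 1) hk z)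
    (hS.integrable_smul hB he0 hei z)] at hc
  rw [hI, negPow_of_pos one_pos, Real.Gamma_one, inv_one, one_smul, one_smul]
  simp_rw [map_add, smul_add]
  rw [integral_add (hS.integrable_smul hB he0 hei _) (hS.integrable_smul hB he0 hei _), hc,
    sub_add_cancel]

theorem negPow_succ_mem_graph [CompleteSpace X] (hS : IsMeasurableSemigroup S)
    (hB : HasExpBound S M w)
    (hw : 0 < w) {A : X →ₗ.[ℂ] X} (hA : IsNegGenerator A S) {α : ℝ} (hα : 0 ≤ α) (z : X) :
    (negPow S (α + 1) z, negPow S α z) ∈ A.graph := by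
  rw [add_comm, ← negPow_negPow hS hB hw zero_le_one hα]
  exact negPow_one_mem_graph hS hB hw hA _

theorem negPow_add_apply (hS : IsMeasurableSemigroup S) (hB : HasExpBound S M w) (hw : 0 < w)
    {α : ℝ} (hα : 0 ≤ α) (y z : X) : negPow S α (y + z) = negPow S α y + negPow S α z := by
  rcases hα.eq_or_lt with rfl | hα
  · simp [negPow_zero]
  have h := powKernel_integrable hα hw
  rw [negPow_of_pos hα, negPow_of_pos hα, negPow_of_pos hα, ← smul_add, ← integral_add
    (hS.integrable_smul hB (powKernel_of_nonpos α) h y)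
    (hS.integrable_smul hB (powKernel_of_nonpos α) h z)]
  simp

theorem negPow_apply_zero (S : ℝ → X →L[ℂ] X) (α : ℝ) : negPow S α 0 = 0 := by
  simp [negPow, fracInt]

/-- For integer exponents, `A^{-(n+1)}y = 0` forces `A^{-n}y = 0` because `A` is single-valued. A
real exponent is first raised to its ceiling by the index law. -/
theorem negPow_eq_zero [CompleteSpace X] (hS : IsMeasurableSemigroup S)
    (hB : HasExpBound S M w) (hw : 0 < w)
    {A : X →ₗ.[ℂ] X} (hA : IsNegGenerator A S) {α : ℝ} (hα : 0 ≤ α) {y : X}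
    (h : negPow S α y = 0) : y = 0 := by
  have hnat : ∀ n : ℕ, negPow S n y = 0 → y = 0 := by
    intro n
    induction n with
    | zero => intro h; rwa [Nat.cast_zero, negPow_zero] at h
    | succ n ih =>
      intro h
      apply ih
      have hg := negPow_succ_mem_graph hS hB hw hA n.cast_nonneg y
      push_cast at h
      rw [h] at hg
      exact LinearPMap.graph_fst_eq_zero_snd _ hg rfl
  apply hnat ⌈α⌉₊
  have h1 := negPow_negPow hS hB hw (sub_nonneg.2 (Nat.le_ceil α)) hα y
  rw [sub_add_cancel, h, negPow_apply_zero] at h1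
  exact h1.symm

theorem negPow_sub_apply (hS : IsMeasurableSemigroup S) (hB : HasExpBound S M w) (hw : 0 < w)
    {α : ℝ} (hα : 0 ≤ α) (y z : X) : negPow S α (y - z) = negPow S α y - negPow S α z := by
  rw [eq_sub_iff_add_eq, ← negPow_add_apply hS hB hw hα, sub_add_cancel]

theorem negPow_injective [CompleteSpace X] (hS : IsMeasurableSemigroup S)
    (hB : HasExpBound S M w) (hw : 0 < w)
    {A : X →ₗ.[ℂ] X} (hA : IsNegGenerator A S) {α : ℝ} (hα : 0 ≤ α) {y z : X}
    (h : negPow S α y = negPow S α z) : y = z :=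
  sub_eq_zero.1 (negPow_eq_zero hS hB hw hA hα (by rw [negPow_sub_apply hS hB hw hα, h, sub_self]))

/-! ### Positive fractional powers as inverses of negative ones. -/

theorem mem_negPowGraph (hS : IsMeasurableSemigroup S) (hB : HasExpBound S M w) (hw : 0 < w)
    {α : ℝ} (hα : 0 < α) (x y : X) : (x, y) ∈ negPowGraph S α ↔ negPow S α y = x := by
  change (IntegrableOn (fun σ : ℝ => σ ^ (α - 1) • S σ y) (Ioi 0) ∧
    (Real.Gamma α)⁻¹ • ∫ σ in Ioi (0 : ℝ), σ ^ (α - 1) • S σ y = x) ↔ _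
  rw [negPow, fracInt, if_neg hα.ne']
  exact and_iff_right (negPow_integrableOn hS hB hw hα y)

theorem fracPow_zero_domain (S : ℝ → X →L[ℂ] X) (x : X) : x ∈ (fracPow S 0).domain := by
  simp [fracPow]

theorem fracPowApply_zero (S : ℝ → X →L[ℂ] X) (x : X) : fracPowApply S 0 x = x := by
  have h : ∀ f : X →ₗ.[ℂ] X, f = LinearMap.id.toPMap ⊤ →
      (open scoped Classical in if h : x ∈ f.domain then f ⟨x, h⟩ else 0) = x := by
    rintro _ rfl
    simp
  exact h _ (by simp [fracPow])

theorem mem_fracPow_domain (hS : IsMeasurableSemigroup S) (hB : HasExpBound S M w) (hw : 0 < w)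
    {α : ℝ} (hα : 0 ≤ α) (x : X) : x ∈ (fracPow S α).domain ↔ ∃ y, negPow S α y = x := by
  rcases hα.eq_or_lt with rfl | hα
  · exact ⟨fun _ => ⟨x, negPow_zero S x⟩, fun _ => fracPow_zero_domain S x⟩
  · rw [fracPow, if_neg hα.ne', Submodule.toLinearPMap_domain]
    simp [mem_negPowGraph hS hB hw hα]

theorem negPow_mem_fracPow_domain (hS : IsMeasurableSemigroup S) (hB : HasExpBound S M w)
    (hw : 0 < w) {α : ℝ} (hα : 0 ≤ α) (y : X) : negPow S α y ∈ (fracPow S α).domain :=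
  (mem_fracPow_domain hS hB hw hα _).2 ⟨y, rfl⟩

theorem fracPowApply_negPow [CompleteSpace X] (hS : IsMeasurableSemigroup S)
    (hB : HasExpBound S M w) (hw : 0 < w)
    {A : X →ₗ.[ℂ] X} (hA : IsNegGenerator A S) {α : ℝ} (hα : 0 ≤ α) (y : X) :
    fracPowApply S α (negPow S α y) = y := by
  rcases hα.eq_or_lt with rfl | hα
  · rw [negPow_zero, fracPowApply_zero]
  -- Only for a single-valued relation does `Submodule.toLinearPMap` have that relation as its
  -- graph; here this is the injectivity of `A^{-α}`.
  have hg : ∀ q ∈ negPowGraph S α, q.1 = 0 → q.2 = 0 := by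
    rintro ⟨a, b⟩ hq h0
    rw [mem_negPowGraph hS hB hw hα] at hq
    exact negPow_eq_zero hS hB hw hA hα.le (hq.trans h0)
  have hdom := negPow_mem_fracPow_domain hS hB hw hα.le y
  rw [fracPowApply, dif_pos hdom]
  have hfp : fracPow S α = (negPowGraph S α).toLinearPMap := by rw [fracPow, if_neg hα.ne']
  have hm : (negPow S α y, fracPow S α ⟨_, hdom⟩) ∈ (fracPow S α).graph :=
    LinearPMap.mem_graph _ ⟨_, hdom⟩
  have hgr : (fracPow S α).graph = negPowGraph S α := by
    rw [hfp, Submodule.toLinearPMap_graph_eq _ hg]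
  rw [hgr, mem_negPowGraph hS hB hw hα] at hm
  exact negPow_injective hS hB hw hA hα.le hm

/-! ### Weak and fractional derivatives of constants. -/

theorem setIntegral_deriv_smul_const [CompleteSpace X] {t₀ : ℝ} {φ : ℝ → ℝ} (hφ : ContDiff ℝ ∞ φ)
    (hc : HasCompactSupport φ) (hs : tsupport φ ⊆ Iio t₀) (c : X) :
    ∫ t in Iio t₀, deriv φ t • c = 0 := by
  rw [integral_smul_const, setIntegral_eq_integral_of_forall_compl_eq_zero,
    integral_eq_zero_of_hasDerivAt_of_integrable
      (fun t => (hφ.differentiable (by simp) t).hasDerivAt)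
      ((hφ.continuous_deriv (by simp)).integrable_of_hasCompactSupport hc.deriv)
      (hφ.continuous.integrable_of_hasCompactSupport hc), zero_smul]
  intro t ht
  by_contra h
  exact ht (hs (tsupport_deriv_subset (𝕜 := ℝ) (f := φ) (subset_tsupport _ h)))

theorem IsWeakDeriv.const [CompleteSpace X] (t₀ : ℝ) (c : X) :
    IsWeakDeriv t₀ (fun _ => c) (fun _ => 0) := by
  intro φ hφ hc hs
  rw [setIntegral_deriv_smul_const hφ hc hs]
  simp

/-- Fundamental lemma of the calculus of variations: the weak derivative is orthogonal to every test
function supported in `(-∞, t₀)`. -/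
theorem IsWeakDeriv.ae_eq_zero_of_const [CompleteSpace X] {t₀ : ℝ} {u du : ℝ → X} {c : X}
    (h : IsWeakDeriv t₀ u du) (hu : u =ᵐ[volume.restrict (Iic t₀)] fun _ => c)
    (hdu : ∀ a, IntegrableOn du (Icc a t₀)) : du =ᵐ[volume.restrict (Iic t₀)] fun _ => 0 := by
  have hloc : LocallyIntegrableOn du (Iio t₀) := by
    intro t ht
    refine ⟨Ioo (t - 1) t₀, ?_, (hdu (t - 1)).mono_set Ioo_subset_Icc_self⟩
    exact mem_nhdsWithin_of_mem_nhds (Ioo_mem_nhds (by linarith) ht)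
  have h0 := isOpen_Iio.ae_eq_zero_of_integral_contDiff_smul_eq_zero (μ := volume) hloc
    (fun φ hφ hc hs => by
      have h1 := h φ hφ hc hs
      have hu' : u =ᵐ[volume.restrict (Iio t₀)] fun _ => c :=
        ae_restrict_of_ae_restrict_of_subset Iio_subset_Iic_self hu
      have h2 : ∫ t in Iio t₀, deriv φ t • u t = ∫ t in Iio t₀, deriv φ t • c :=
        integral_congr_ae (hu'.mono fun t ht => by simp only [ht])
      rw [h2, setIntegral_deriv_smul_const hφ hc hs, zero_eq_neg,
        setIntegral_eq_integral_of_forall_compl_eq_zero] at h1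
      · exact h1
      · intro t ht
        rw [image_eq_zero_of_notMem_tsupport fun h' => ht (hs h'), zero_smul])
  rw [restrict_Iio_eq_restrict_Iic.symm]
  exact (ae_restrict_iff' measurableSet_Iio).2 h0

theorem integrableOn_of_halfLp {X : Type*} [NormedAddCommGroup X] {p : ℝ≥0∞} (hp : 1 ≤ p)
    {t₀ : ℝ} {F : (ℝ → X) → Prop}
    (hF : F = HalfLp p t₀ ∨ F = HalfLpLoc p t₀) {u : ℝ → X} (hu : F u) (a : ℝ) :
    IntegrableOn u (Icc a t₀) := by
  have h : MemLp u p (volume.restrict (Icc a t₀)) := by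
    rcases hF with rfl | rfl
    · exact MemLp.mono_measure (Measure.restrict_mono_set _ Icc_subset_Iic_self) hu
    · exact hu a
  exact h.integrable hp

theorem graph_snd_unique {A : X →ₗ.[ℂ] X} {x y z : X} (h1 : (x, y) ∈ A.graph)
    (h2 : (x, z) ∈ A.graph) : y = z := LinearPMap.mem_graph_snd_inj A h1 h2 rfl

/-- The iteration runs through the constants `A^{-(⌈β⌉-j)}y`: time derivatives vanish, and each
application of `A` lowers the negative power by one. -/
theorem isFracDeriv_const [CompleteSpace X] (hS : IsMeasurableSemigroup S)
    (hB : HasExpBound S M w) (hw : 0 < w) {A : X →ₗ.[ℂ] X} (hA : IsNegGenerator A S)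
    {F : (ℝ → X) → Prop} (hF : ∀ c : X, F fun _ => c) (t₀ : ℝ) {β : ℝ} (hβ : 0 ≤ β) (y : X) :
    IsFracDeriv A S F t₀ β (fun _ => negPow S β y) (fun _ => y) := by
  have hα : 0 ≤ (⌈β⌉₊ : ℝ) - β := sub_nonneg.2 (Nat.le_ceil β)
  refine ⟨hF _, ?_, fun j _ => negPow S ((⌈β⌉₊ - j : ℕ) : ℝ) y, hF _, ?_, ?_, ?_⟩
  · rcases hα.eq_or_lt with h | h
    · exact Or.inl h.symm
    · exact Or.inr (ae_of_all _ fun _ => negPow_integrableOn hS hB hw h _)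
  · refine ae_of_all _ fun t => ?_
    -- `𝔍` of a constant does not depend on time, so it is definitionally `negPow`.
    change negPow S ((⌈β⌉₊ - 0 : ℕ) : ℝ) y = negPow S _ (negPow S β y)
    rw [negPow_negPow hS hB hw hα hβ, sub_add_cancel, Nat.sub_zero]
  · intro j hj
    refine ⟨hF _, fun _ => 0, fun _ => negPow S ((⌈β⌉₊ - (j + 1) : ℕ) : ℝ) y, hF _, hF _,
      IsWeakDeriv.const _ _, ae_of_all _ fun _ => ?_, ae_of_all _ fun _ => (zero_add _).symm⟩
    have h := negPow_succ_mem_graph hS hB hw hA (Nat.cast_nonneg (⌈β⌉₊ - (j + 1))) y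
    have h' : ((⌈β⌉₊ - (j + 1) : ℕ) : ℝ) + 1 = ((⌈β⌉₊ - j : ℕ) : ℝ) := by
      exact_mod_cast (by omega : ⌈β⌉₊ - (j + 1) + 1 = ⌈β⌉₊ - j)
    rwa [h'] at h
  · refine ae_of_all _ fun t => ?_
    simp [negPow_zero]

/-- The definition of a solution allows any admissible chain and any representative. Inductively
each member of the chain is almost everywhere constant, so its weak derivative vanishes and
single-valuedness of `A` determines the next one. -/
theorem IsFracDeriv.ae_eq_of_const [CompleteSpace X] (hS : IsMeasurableSemigroup S)
    (hB : HasExpBound S M w) (hw : 0 < w) {A : X →ₗ.[ℂ] X} (hA : IsNegGenerator A S)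
    {F : (ℝ → X) → Prop} {t₀ : ℝ} (hF : ∀ u, F u → ∀ a, IntegrableOn u (Icc a t₀))
    {β : ℝ} (hβ : 0 ≤ β) {y : X} {v : ℝ → X}
    (h : IsFracDeriv A S F t₀ β (fun _ => negPow S β y) v) :
    v =ᵐ[volume.restrict (Iic t₀)] fun _ => y := by
  have hα : 0 ≤ (⌈β⌉₊ : ℝ) - β := sub_nonneg.2 (Nat.le_ceil β)
  obtain ⟨-, -, U, -, hU0, hU, hUn⟩ := h
  have key : ∀ j ≤ ⌈β⌉₊, U j =ᵐ[volume.restrict (Iic t₀)]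
      fun _ => negPow S ((⌈β⌉₊ - j : ℕ) : ℝ) y := by
    intro j
    induction j with
    | zero =>
      intro _
      refine hU0.trans (ae_of_all _ fun t => ?_)
      change negPow S _ (negPow S β y) = _
      rw [negPow_negPow hS hB hw hα hβ, sub_add_cancel, Nat.sub_zero]
    | succ j ih =>
      intro hj
      have hj' := ih (by omega)
      obtain ⟨-, du, au, hdu, -, hw', hgr, hv⟩ := hU j (by omega)
      have hdu0 := hw'.ae_eq_zero_of_const hj' (hF du hdu)
      filter_upwards [hj', hdu0, hgr, hv] with t h1 h2 h3 h4
      rw [h4, h2, zero_add]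
      rw [h1] at h3
      have h := negPow_succ_mem_graph hS hB hw hA (Nat.cast_nonneg (⌈β⌉₊ - (j + 1))) y
      have h' : ((⌈β⌉₊ - (j + 1) : ℕ) : ℝ) + 1 = ((⌈β⌉₊ - j : ℕ) : ℝ) := by
        exact_mod_cast (by omega : ⌈β⌉₊ - (j + 1) + 1 = ⌈β⌉₊ - j)
      rw [h'] at h
      exact graph_snd_unique h3 h
  refine hUn.symm.trans ((key _ le_rfl).trans (ae_of_all _ fun t => ?_))
  simp [negPow_zero]

/-- Passes from almost everywhere to the single point `t₀`: a nondegenerate interval ending at `t₀`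
suffices, by one-sided continuity. -/
theorem eq_of_ae_eq_const {X : Type*} [NormedAddCommGroup X] {t₀ : ℝ} {v : ℝ → X}
    (hv : ContinuousOn v (Iic t₀)) {c : X}
    (h : v =ᵐ[volume.restrict (Iic t₀)] fun _ => c) : v t₀ = c := by
  have h1 : v =ᵐ[volume.restrict (Icc (t₀ - 1) t₀)] fun _ => c :=
    ae_restrict_of_ae_restrict_of_subset Icc_subset_Iic_self h
  exact Measure.eqOn_Icc_of_ae_eq volume (by linarith) h1 (hv.mono Icc_subset_Iic_self)
    continuousOn_const ⟨by linarith, le_rfl⟩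

theorem isFracDeriv_zero (A : X →ₗ.[ℂ] X) (S : ℝ → X →L[ℂ] X) {F : (ℝ → X) → Prop} (t₀ : ℝ)
    {g : ℝ → X} (hg : F g) : IsFracDeriv A S F t₀ 0 g g := by
  refine ⟨hg, Or.inl (by simp), fun _ => g, hg, ?_, by simp, ae_eq_refl _⟩
  refine ae_of_all _ fun t => ?_
  simp [fracInt]

/-! ### The incomplete gamma function as a Laplace transform. -/

/-- The Laplace transform of a power, at complex arguments in the right half-plane. -/
theorem integral_rpow_mul_cexp_neg_mul_Ioi {c : ℝ} (hc : 0 < c) {z : ℂ} (hz : 0 < z.re) :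
    ∫ t in Ioi (0 : ℝ), ((t ^ (c - 1) : ℝ) : ℂ) * Complex.exp (-(z * t)) =
      z ^ (-(c : ℂ)) * Real.Gamma c := by
  -- Viewing the integral as a complex moment generating function gives analyticity in `z`. Both
  -- sides agree for real `z > 0` by the Gamma integral, hence on the half-plane by the identity
  -- theorem.
  set μ : Measure ℝ := (volume.restrict (Ioi 0)).withDensity
    fun t => ENNReal.ofReal (t ^ (c - 1)) with hμ
  have hmeas : Measurable fun t : ℝ => ENNReal.ofReal (t ^ (c - 1)) := by fun_prop
  have hfin : ∀ᵐ t ∂volume.restrict (Ioi (0 : ℝ)), ENNReal.ofReal (t ^ (c - 1)) < ⊤ :=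
    ae_of_all _ fun _ => ENNReal.ofReal_lt_top
  have hG : ∀ ζ : ℂ, ProbabilityTheory.complexMGF id μ (-ζ) =
      ∫ t in Ioi (0 : ℝ), ((t ^ (c - 1) : ℝ) : ℂ) * Complex.exp (-(ζ * t)) := by
    intro ζ
    rw [ProbabilityTheory.complexMGF, hμ,
      integral_withDensity_eq_integral_toReal_smul hmeas hfin]
    refine setIntegral_congr_fun measurableSet_Ioi fun t ht => ?_
    simp only [id]
    rw [ENNReal.toReal_ofReal (Real.rpow_nonneg (le_of_lt ht) _), Complex.real_smul, neg_mul]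
  have hint : Iio (0 : ℝ) ⊆ interior (ProbabilityTheory.integrableExpSet id μ) := by
    rw [isOpen_Iio.subset_interior_iff]
    intro r hr
    have h := integrableOn_rpow_mul_exp_neg_mul_rpow (s := c - 1) (p := 1) (b := -r)
      (by linarith) one_pos (neg_pos.2 hr)
    change Integrable (fun t : ℝ => Real.exp (r * t)) μ
    rw [hμ, integrable_withDensity_iff_integrable_smul' hmeas hfin]
    refine h.congr ?_
    filter_upwards [ae_restrict_mem measurableSet_Ioi] with t ht
    rw [ENNReal.toReal_ofReal (Real.rpow_nonneg (le_of_lt ht) _)]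
    simp
  have hU : IsOpen {ζ : ℂ | 0 < ζ.re} := isOpen_lt continuous_const Complex.continuous_re
  have h1 : AnalyticOnNhd ℂ (fun ζ => ProbabilityTheory.complexMGF id μ (-ζ))
      {ζ : ℂ | 0 < ζ.re} := by
    refine DifferentiableOn.analyticOnNhd (fun ζ hζ => ?_) hU
    have hd : DifferentiableAt ℂ (ProbabilityTheory.complexMGF id μ) (-ζ) :=
      (ProbabilityTheory.analyticAt_complexMGF (hint (by simpa using hζ))).differentiableAt
    exact (hd.comp ζ differentiableAt_id.neg).differentiableWithinAt
  have h2 : AnalyticOnNhd ℂ (fun ζ : ℂ => ζ ^ (-(c : ℂ)) * Real.Gamma c)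
      {ζ : ℂ | 0 < ζ.re} := by
    refine DifferentiableOn.analyticOnNhd (fun ζ hζ => ?_) hU
    exact ((differentiableAt_id.cpow_const (Or.inl hζ)).mul_const _).differentiableWithinAt
  have hreal : ∀ r : ℝ, 0 < r → ProbabilityTheory.complexMGF id μ (-(r : ℂ)) =
      (r : ℂ) ^ (-(c : ℂ)) * Real.Gamma c := by
    intro r hr
    rw [hG]
    have h := Real.integral_rpow_mul_exp_neg_mul_Ioi hc hr
    have h3 : ∫ t in Ioi (0 : ℝ), ((t ^ (c - 1) : ℝ) : ℂ) * Complex.exp (-((r : ℂ) * t)) =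
        ((∫ t in Ioi (0 : ℝ), t ^ (c - 1) * Real.exp (-(r * t)) : ℝ) : ℂ) := by
      rw [← integral_complex_ofReal]
      refine integral_congr_ae (ae_of_all _ fun t => ?_)
      push_cast; rfl
    rw [h3, h, one_div, Real.inv_rpow hr.le, ← Real.rpow_neg hr.le]
    push_cast [Complex.ofReal_cpow hr.le]
    rfl
  have hconn : IsPreconnected {ζ : ℂ | 0 < ζ.re} := (convex_halfSpace_re_gt 0).isPreconnected
  have hfreq : ∃ᶠ ζ in 𝓝[≠] (1 : ℂ), ProbabilityTheory.complexMGF id μ (-ζ) =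
      ζ ^ (-(c : ℂ)) * Real.Gamma c := by
    have ht : Tendsto (fun r : ℝ => (r : ℂ)) (𝓝[≠] (1 : ℝ)) (𝓝[≠] (1 : ℂ)) := by
      refine tendsto_nhdsWithin_iff.2 ⟨?_, ?_⟩
      · exact (Complex.continuous_ofReal.tendsto' 1 1 (by simp)).mono_left nhdsWithin_le_nhds
      · filter_upwards [self_mem_nhdsWithin] with r hr
        simpa using hr
    refine ht.frequently (Eventually.frequently ?_)
    filter_upwards [mem_nhdsWithin_of_mem_nhds (Ioi_mem_nhds (zero_lt_one' ℝ))] with r hr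
    exact hreal r hr
  rw [← hG]
  exact h1.eqOn_of_preconnected_of_frequently_eq h2 hconn (by simp) hfreq hz

theorem integrableOn_rpow_neg_div_add_one {α : ℝ} (h0 : 0 < α) (h1 : α < 1) :
    IntegrableOn (fun τ : ℝ => τ ^ (-α) / (τ + 1)) (Ioi 0) := by
  have hm : Measurable fun τ : ℝ => τ ^ (-α) / (τ + 1) := by fun_prop
  rw [← Ioc_union_Ioi_eq_Ioi (zero_le_one' ℝ)]
  refine IntegrableOn.union ?_ ?_
  · have h : IntegrableOn (fun τ : ℝ => τ ^ (-α)) (Ioc 0 1) :=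
      (intervalIntegrable_iff_integrableOn_Ioc_of_le zero_le_one).1
        (intervalIntegral.intervalIntegrable_rpow' (by linarith))
    refine h.mono' hm.aestronglyMeasurable ?_
    filter_upwards [ae_restrict_mem measurableSet_Ioc] with τ hτ
    have := Real.rpow_nonneg hτ.1.le (-α)
    rw [Real.norm_of_nonneg (div_nonneg this (by linarith [hτ.1]))]
    exact div_le_self this (by linarith [hτ.1])
  · refine (integrableOn_Ioi_rpow_of_lt (a := -α - 1) (by linarith) one_pos).mono'
      hm.aestronglyMeasurable ?_
    filter_upwards [ae_restrict_mem measurableSet_Ioi] with τ hτ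
    have hτ0 : (0 : ℝ) < τ := one_pos.trans hτ
    have := Real.rpow_nonneg hτ0.le (-α)
    rw [Real.norm_of_nonneg (div_nonneg this (by linarith)), Real.rpow_sub_one hτ0.ne']
    gcongr
    linarith

/-- Write `(z+r)^{α-1}` as `Γ(1-α)⁻¹ ∫ σ^{-α} e^{-(z+r)σ} dσ`, legitimate for `r > 0` even if `Re z
= 0`. Then swap the integrals, use `∫ e^{-(σ+1)r} dr = 1/(σ+1)`, and apply the reflection formula
for `Γ(α)Γ(1-α)`. -/
theorem incGamma_eq_integral {α : ℝ} (h0 : 0 < α) (h1 : α < 1) {z : ℂ} (hz : 0 ≤ z.re) :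
    incGamma α z = ((Real.sin (Real.pi * α) / Real.pi : ℝ) : ℂ) *
      ∫ τ in Ioi (0 : ℝ), ((τ ^ (-α) / (τ + 1) : ℝ) : ℂ) * Complex.exp (-(z * (τ + 1))) := by
  set μ := volume.restrict (Ioi (0 : ℝ)) with hμ
  set G : ℝ → ℝ → ℂ := fun r σ =>
    ((σ ^ (-α) : ℝ) : ℂ) * Complex.exp (-(z * (σ + 1))) * Complex.exp (-((σ + 1 : ℝ) * r))
    with hG
  have hΓ := (Real.Gamma_pos_of_pos (sub_pos.2 h1)).ne'
  have hinner : ∀ r ∈ Ioi (0 : ℝ), (z + r) ^ ((α : ℂ) - 1) * Complex.exp (-(z + r)) =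
      (Real.Gamma (1 - α) : ℂ)⁻¹ * ∫ σ, G r σ ∂μ := by
    intro r hr
    have hre : 0 < (z + r).re := by
      simp only [Complex.add_re, Complex.ofReal_re]
      have : (0 : ℝ) < r := hr
      linarith
    have h := integral_rpow_mul_cexp_neg_mul_Ioi (sub_pos.2 h1) hre
    have h2 : ∫ σ, G r σ ∂μ = (∫ σ in Ioi (0 : ℝ), ((σ ^ ((1 - α) - 1) : ℝ) : ℂ) *
        Complex.exp (-((z + r) * σ))) * Complex.exp (-(z + r)) := by
      rw [← integral_mul_const]
      refine integral_congr_ae (ae_of_all _ fun σ => ?_)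
      simp only [hG]
      rw [mul_assoc, mul_assoc, ← Complex.exp_add, ← Complex.exp_add,
        show (1 - α) - 1 = -α by ring]
      congr 2
      push_cast; ring
    rw [h2, h]
    have : (Real.Gamma (1 - α) : ℂ) ≠ 0 := by exact_mod_cast hΓ
    push_cast
    rw [show (-(1 - (α : ℂ))) = α - 1 by ring]
    field_simp
  have hexp : ∀ σ ∈ Ioi (0 : ℝ), ∫ r, Complex.exp (-((σ + 1 : ℝ) * r)) ∂μ =
      ((σ + 1 : ℝ) : ℂ)⁻¹ := by
    intro σ hσ
    have hσ' : (0 : ℝ) < σ + 1 := by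
      have : (0 : ℝ) < σ := hσ
      linarith
    have h := integral_rpow_mul_cexp_neg_mul_Ioi (z := ((σ + 1 : ℝ) : ℂ)) one_pos
      (by simpa using hσ')
    simpa [Complex.cpow_neg] using h
  have hnorm : ∀ r σ : ℝ, 0 < σ → ‖G r σ‖ = σ ^ (-α) * Real.exp (-(z.re * (σ + 1))) *
      Real.exp (-((σ + 1) * r)) := by
    intro r σ hσ
    rw [hG]
    simp only [norm_mul, Complex.norm_exp, Complex.norm_real]
    rw [Real.norm_of_nonneg (Real.rpow_nonneg hσ.le _)]
    simp
  have hexpi : ∀ σ ∈ Ioi (0 : ℝ), Integrable (fun r : ℝ => Real.exp (-((σ + 1) * r))) μ := by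
    intro σ hσ
    have hσ' : (0 : ℝ) < σ + 1 := by
      have : (0 : ℝ) < σ := hσ
      linarith
    simp_rw [← neg_mul]
    exact exp_neg_integrableOn_Ioi 0 hσ'
  have hGm : AEStronglyMeasurable (fun q : ℝ × ℝ => G q.1 q.2) (μ.prod μ) := by
    have : Measurable fun q : ℝ × ℝ => G q.1 q.2 := by
      simp only [hG]; fun_prop
    exact this.aestronglyMeasurable
  have hGi : Integrable (fun q : ℝ × ℝ => G q.1 q.2) (μ.prod μ) := by
    rw [integrable_prod_iff' hGm]
    constructor
    · filter_upwards [ae_restrict_mem measurableSet_Ioi] with σ hσ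
      have hm : Measurable fun r => G r σ := by
        simp only [hG]; fun_prop
      refine ((hexpi σ hσ).const_mul (σ ^ (-α) * Real.exp (-(z.re * (σ + 1))))).mono'
        hm.aestronglyMeasurable (ae_of_all _ fun r => (hnorm r σ hσ).le)
    -- The factor `e^{-Re z (σ+1)} ≤ 1` is discarded, so the argument includes the imaginary axis,
    -- as the Phillips calculus requires.
    · refine (integrableOn_rpow_neg_div_add_one h0 h1).mono'
        (hGm.norm.prod_swap.integral_prod_right') ?_
      filter_upwards [ae_restrict_mem measurableSet_Ioi] with σ hσ
      have hσ' : (0 : ℝ) < σ := hσ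
      have he : ∫ r, Real.exp (-((σ + 1) * r)) ∂μ = (σ + 1)⁻¹ := by
        have := integral_exp_mul_Ioi (a := -(σ + 1)) (by linarith) 0
        simp_rw [← neg_mul]
        rw [this, mul_zero, Real.exp_zero, neg_div_neg_eq, one_div]
      simp_rw [fun r => hnorm r σ hσ']
      rw [integral_const_mul, he, Real.norm_of_nonneg (by positivity), div_eq_mul_inv]
      refine mul_le_mul_of_nonneg_right ?_ (by positivity)
      refine mul_le_of_le_one_right (by positivity) (Real.exp_le_one_iff.2 ?_)
      nlinarith
  rw [incGamma, setIntegral_congr_fun measurableSet_Ioi hinner, integral_const_mul,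
    integral_integral_swap hGi]
  have hfin : ∫ σ, ∫ r, G r σ ∂μ ∂μ =
      ∫ τ in Ioi (0 : ℝ), ((τ ^ (-α) / (τ + 1) : ℝ) : ℂ) * Complex.exp (-(z * (τ + 1))) := by
    refine setIntegral_congr_fun measurableSet_Ioi fun σ hσ => ?_
    simp only [hG]
    rw [integral_const_mul, hexp σ hσ]
    push_cast
    ring
  rw [hfin, ← mul_assoc]
  congr 1
  have h := Real.Gamma_mul_Gamma_one_sub α
  rw [← Complex.ofReal_inv, ← Complex.ofReal_inv, ← Complex.ofReal_mul, ← mul_inv, h, inv_div]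

/-! ### Uniqueness in the Phillips calculus. -/

theorem norm_cexp_real_mul_I (ξ r : ℝ) : ‖Complex.exp (ξ * r * Complex.I)‖ = 1 := by
  rw [← Complex.ofReal_mul, Complex.norm_exp_ofReal_mul_I]

theorem integrable_cexp_mul {μ : Measure ℝ} {f : ℝ → ℂ} (hf : Integrable f μ) (ξ : ℝ) :
    Integrable (fun r : ℝ => Complex.exp (ξ * r * Complex.I) * f r) μ := by
  have hc : Continuous fun r : ℝ => Complex.exp (ξ * r * Complex.I) := by fun_prop
  refine hf.mono (hc.aestronglyMeasurable.mul hf.aestronglyMeasurable) (ae_of_all _ fun r => ?_)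
  rw [norm_mul, norm_cexp_real_mul_I, one_mul]

/-- The positive and negative parts of `g` are densities of two finite positive measures with equal
characteristic functions, hence agree almost everywhere; but at each point at most one of them is
nonzero. -/
theorem ae_eq_zero_of_fourier_real {μ : Measure ℝ} [IsFiniteMeasure μ] {g : ℝ → ℝ}
    (hg : Integrable g μ)
    (h : ∀ ξ : ℝ, ∫ r, Complex.exp (ξ * r * Complex.I) * (g r : ℂ) ∂μ = 0) : g =ᵐ[μ] 0 := by
  have hfin := isFiniteMeasure_withDensity_ofReal hg.hasFiniteIntegral
  have hfin' := isFiniteMeasure_withDensity_ofReal hg.neg.hasFiniteIntegral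
  have hm : AEMeasurable (fun r => ENNReal.ofReal (g r)) μ := hg.aemeasurable.ennreal_ofReal
  have hm' : AEMeasurable (fun r => ENNReal.ofReal ((-g) r)) μ :=
    hg.neg.aemeasurable.ennreal_ofReal
  have hint : ∀ (ξ : ℝ) (f : ℝ → ℝ), Integrable f μ →
      Integrable (fun r => (max (f r) 0) • Complex.exp (ξ * r * Complex.I)) μ := by
    intro ξ f hf
    refine hf.pos_part.mono
      (hf.pos_part.aestronglyMeasurable.smul (by fun_prop)) (ae_of_all _ fun r => ?_)
    rw [norm_smul, norm_cexp_real_mul_I, mul_one]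
  have hEq : μ.withDensity (fun r => ENNReal.ofReal (g r)) =
      μ.withDensity (fun r => ENNReal.ofReal ((-g) r)) := by
    refine Measure.ext_of_charFun (funext fun ξ => ?_)
    rw [charFun_apply_real, charFun_apply_real,
      integral_withDensity_eq_integral_toReal_smul₀ hm (ae_of_all _ fun _ => ENNReal.ofReal_lt_top),
      integral_withDensity_eq_integral_toReal_smul₀ hm'
        (ae_of_all _ fun _ => ENNReal.ofReal_lt_top),
      ← sub_eq_zero]
    simp only [ENNReal.toReal_ofReal']
    rw [← integral_sub (hint ξ g hg) (hint ξ (-g) hg.neg), ← h ξ]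
    refine integral_congr_ae (ae_of_all _ fun r => ?_)
    simp only [Pi.neg_apply]
    rw [← sub_smul, Complex.real_smul, mul_comm]
    congr 2
    rcases le_total (g r) 0 with h0 | h0
    · rw [max_eq_right h0, max_eq_left (by linarith)]; ring
    · rw [max_eq_left h0, max_eq_right (by linarith)]; ring
  rw [withDensity_eq_iff_of_sigmaFinite hm hm'] at hEq
  filter_upwards [hEq] with r hr
  rcases lt_trichotomy (g r) 0 with h0 | h0 | h0
  · rw [ENNReal.ofReal_of_nonpos h0.le, eq_comm, ENNReal.ofReal_eq_zero] at hr
    simp only [Pi.neg_apply] at hr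
    linarith
  · exact h0
  · rw [ENNReal.ofReal_of_nonpos (p := (-g) r) (by simpa using h0.le),
      ENNReal.ofReal_eq_zero] at hr
    linarith

/-- Uniqueness for Fourier transforms of complex measures. -/
theorem ae_eq_zero_of_fourier {μ : Measure ℝ} [IsFiniteMeasure μ] {K : ℝ → ℂ}
    (hK : Integrable K μ)
    (h : ∀ ξ : ℝ, ∫ r, Complex.exp (ξ * r * Complex.I) * K r ∂μ = 0) : K =ᵐ[μ] 0 := by
  have hKc : Integrable (fun r => (starRingEnd ℂ) (K r)) μ :=
    (Complex.conjCLE : ℂ →L[ℝ] ℂ).integrable_comp hK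
  -- Conjugating the hypothesis at `-ξ` shows that the conjugate of `K` has zero transform too,
  -- which separates real and imaginary parts.
  have hc : ∀ ξ : ℝ, ∫ r, Complex.exp (ξ * r * Complex.I) * (starRingEnd ℂ) (K r) ∂μ = 0 := by
    intro ξ
    have h1 := congrArg (starRingEnd ℂ) (h (-ξ))
    rw [← integral_conj, map_zero] at h1
    rw [← h1]
    refine integral_congr_ae (ae_of_all _ fun r => ?_)
    simp only
    rw [map_mul, ← Complex.exp_conj]
    simp
  have hre := ae_eq_zero_of_fourier_real hK.re fun ξ => by
    have h2 : ∀ r : ℝ, Complex.exp (ξ * r * Complex.I) * ((RCLike.re (K r) : ℝ) : ℂ) =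
        (2 : ℂ)⁻¹ * (Complex.exp (ξ * r * Complex.I) * K r +
          Complex.exp (ξ * r * Complex.I) * (starRingEnd ℂ) (K r)) := by
      intro r
      rw [← mul_add, Complex.add_conj]
      simp only [RCLike.re_to_complex]
      push_cast; ring
    simp_rw [h2]
    rw [integral_const_mul, integral_add (integrable_cexp_mul hK ξ) (integrable_cexp_mul hKc ξ),
      h, hc]
    simp
  have him := ae_eq_zero_of_fourier_real hK.im fun ξ => by
    have h2 : ∀ r : ℝ, Complex.exp (ξ * r * Complex.I) * ((RCLike.im (K r) : ℝ) : ℂ) =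
        (2 * Complex.I)⁻¹ * (Complex.exp (ξ * r * Complex.I) * K r -
          Complex.exp (ξ * r * Complex.I) * (starRingEnd ℂ) (K r)) := by
      intro r
      rw [← mul_sub, Complex.sub_conj]
      simp only [RCLike.im_to_complex]
      have := Complex.I_ne_zero
      field_simp
      push_cast; ring
    simp_rw [h2]
    rw [integral_const_mul, integral_sub (integrable_cexp_mul hK ξ) (integrable_cexp_mul hKc ξ),
      h, hc]
    simp
  filter_upwards [hre, him] with r h1 h2
  exact Complex.ext h1 h2

/-- On the imaginary axis `f` is the Fourier transform of the representing complex measure. Both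
representations are written as densities against the common dominating measure `ν + ν'`, where
Fourier uniqueness applies. -/
theorem IsPhillips.unique {f : ℂ → ℂ} {T T' : X →L[ℂ] X} (h : IsPhillips S f T)
    (h' : IsPhillips S f T') : T = T' := by
  obtain ⟨ν, k, hν, -, hk, hf, hT⟩ := h
  obtain ⟨ν', k', hν', -, hk', hf', hT'⟩ := h'
  set μ := ν + ν' with hμ
  have hac : ν ≪ μ := Measure.absolutelyContinuous_of_le (Measure.le_add_right le_rfl)
  have hac' : ν' ≪ μ := Measure.absolutelyContinuous_of_le (Measure.le_add_left le_rfl)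
  set K : ℝ → ℂ := fun r => (ν.rnDeriv μ r).toReal • k r with hK
  set K' : ℝ → ℂ := fun r => (ν'.rnDeriv μ r).toReal • k' r with hK'
  have hKi : Integrable K μ := (integrable_rnDeriv_smul_iff hac).2 hk
  have hKi' : Integrable K' μ := (integrable_rnDeriv_smul_iff hac').2 hk'
  have hz := ae_eq_zero_of_fourier (hKi.sub hKi') fun ξ => by
    have e1 : ∫ r, Complex.exp (ξ * r * Complex.I) * K r ∂μ = f (-(ξ * Complex.I)) := by
      rw [hf _ (by simp), ← integral_rnDeriv_smul hac]
      refine integral_congr_ae (ae_of_all _ fun r => ?_)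
      simp only [hK]
      rw [mul_smul_comm]
      congr 3
      ring
    have e2 : ∫ r, Complex.exp (ξ * r * Complex.I) * K' r ∂μ = f (-(ξ * Complex.I)) := by
      rw [hf' _ (by simp), ← integral_rnDeriv_smul hac']
      refine integral_congr_ae (ae_of_all _ fun r => ?_)
      simp only [hK']
      rw [mul_smul_comm]
      congr 3
      ring
    simp only [Pi.sub_apply, mul_sub]
    rw [integral_sub (integrable_cexp_mul hKi ξ) (integrable_cexp_mul hKi' ξ), e1, e2, sub_self]
  ext x
  rw [(hT x).2, (hT' x).2, ← integral_rnDeriv_smul hac, ← integral_rnDeriv_smul hac']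
  refine integral_congr_ae ?_
  filter_upwards [hz] with r hr
  have hr' : K r = K' r := sub_eq_zero.1 hr
  rw [← smul_assoc, ← smul_assoc]
  exact congrArg (· • S r x) hr'

theorem phillips_eq {f : ℂ → ℂ} {T : X →L[ℂ] X} (h : IsPhillips S f T) : phillips S f = T := by
  have hex : ∃ T, IsPhillips S f T := ⟨T, h⟩
  rw [phillips, dif_pos hex]
  exact hex.choose_spec.unique h

/-! ### The operator-valued incomplete gamma function of order below one. -/

theorem IsMeasurableSemigroup.aestronglyMeasurable_affine (hS : IsMeasurableSemigroup S) {t : ℝ}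
    (ht : 0 < t) (x : X) :
    AEStronglyMeasurable (fun τ : ℝ => S (t * (τ + 1)) x) (volume.restrict (Ioi 0)) := by
  have h1 : Measure.QuasiMeasurePreserving (fun r : ℝ => t * r) volume volume := by
    refine ⟨by fun_prop, ?_⟩
    rw [Real.map_volume_mul_left ht.ne']
    exact Measure.smul_absolutelyContinuous
  have h2 : Measure.QuasiMeasurePreserving (fun τ : ℝ => t * (τ + 1)) volume volume :=
    h1.comp (measurePreserving_add_right volume 1).quasiMeasurePreserving
  have hmaps : MapsTo (fun τ : ℝ => t * (τ + 1)) (Ioi 0) (Ioi 0) := fun τ hτ => by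
    have : (0 : ℝ) < τ := hτ
    exact mul_pos ht (by linarith)
  exact (hS.meas x).comp_quasiMeasurePreserving (h2.restrict hmaps)

theorem integrableOn_kernel_smul (hS : IsMeasurableSemigroup S) (hB : HasExpBound S M w)
    (hw : 0 ≤ w) {α : ℝ} (h0 : 0 < α) (h1 : α < 1) {t : ℝ} (ht : 0 < t) (x : X) :
    IntegrableOn (fun τ : ℝ => (τ ^ (-α) / (τ + 1)) • S (t * (τ + 1)) x) (Ioi 0) := by
  have hi := integrableOn_rpow_neg_div_add_one h0 h1
  refine (hi.norm.mul_const (M * ‖x‖)).mono'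
    (hi.aestronglyMeasurable.smul (hS.aestronglyMeasurable_affine ht x)) ?_
  filter_upwards [ae_restrict_mem measurableSet_Ioi] with τ hτ
  have hτ0 : (0 : ℝ) < τ := hτ
  rw [norm_smul]
  refine mul_le_mul_of_nonneg_left ?_ (norm_nonneg _)
  have hM := hB.1
  refine (S _).le_of_opNorm_le ((hB.2 _ (by positivity)).trans ?_) x
  refine mul_le_of_le_one_right (by linarith) (Real.exp_le_one_iff.2 ?_)
  have : 0 ≤ w * (t * (τ + 1)) := by positivity
  linarith

/-- The kernel is positive, so the bound on `‖S(t(τ+1))‖` can be inserted under the integral, and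
`incGamma_eq_integral` at `z = wt` reassembles the result. -/
theorem norm_integral_kernel_le (hB : HasExpBound S M w)
    (hw : 0 ≤ w) {α : ℝ} (h0 : 0 < α) (h1 : α < 1) {t : ℝ} (ht : 0 < t) (x : X) :
    ‖(Real.sin (Real.pi * α) / Real.pi) •
        ∫ τ in Ioi (0 : ℝ), (τ ^ (-α) / (τ + 1)) • S (t * (τ + 1)) x‖ ≤
      M * (incGamma α ((w * t : ℝ) : ℂ)).re * ‖x‖ := by
  have hwt : 0 ≤ w * t := by positivity
  have hM := hB.1
  have hsin : 0 ≤ Real.sin (Real.pi * α) / Real.pi := by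
    refine div_nonneg (Real.sin_nonneg_of_nonneg_of_le_pi (by positivity) ?_) Real.pi_pos.le
    nlinarith [Real.pi_pos]
  have hinc : (incGamma α ((w * t : ℝ) : ℂ)).re = Real.sin (Real.pi * α) / Real.pi *
      ∫ τ in Ioi (0 : ℝ), τ ^ (-α) / (τ + 1) * Real.exp (-(w * t * (τ + 1))) := by
    rw [incGamma_eq_integral h0 h1 (by simpa using hwt), Complex.re_ofReal_mul]
    congr 1
    have h3 : ∫ τ in Ioi (0 : ℝ), ((τ ^ (-α) / (τ + 1) : ℝ) : ℂ) *
        Complex.exp (-(((w * t : ℝ) : ℂ) * (τ + 1))) =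
        ((∫ τ in Ioi (0 : ℝ), τ ^ (-α) / (τ + 1) * Real.exp (-(w * t * (τ + 1))) : ℝ) : ℂ) := by
      rw [← integral_complex_ofReal]
      refine integral_congr_ae (ae_of_all _ fun τ => ?_)
      push_cast; rfl
    rw [h3, Complex.ofReal_re]
  rw [hinc, norm_smul, Real.norm_of_nonneg hsin]
  have hi := integrableOn_rpow_neg_div_add_one h0 h1
  have hbi : IntegrableOn
      (fun τ : ℝ => τ ^ (-α) / (τ + 1) * Real.exp (-(w * t * (τ + 1))) * (M * ‖x‖)) (Ioi 0) := by
    have hc : Continuous fun τ : ℝ => Real.exp (-(w * t * (τ + 1))) := by fun_prop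
    refine Integrable.mul_const (Integrable.mono hi
      (hi.aestronglyMeasurable.mul hc.aestronglyMeasurable) ?_) _
    filter_upwards [ae_restrict_mem measurableSet_Ioi] with τ hτ
    have hτ0 : (0 : ℝ) < τ := hτ
    rw [Pi.mul_apply, norm_mul]
    refine mul_le_of_le_one_right (norm_nonneg _) ?_
    rw [Real.norm_of_nonneg (Real.exp_pos _).le, Real.exp_le_one_iff]
    have : 0 ≤ w * t * (τ + 1) := by positivity
    linarith
  have hn : ‖∫ τ in Ioi (0 : ℝ), (τ ^ (-α) / (τ + 1)) • S (t * (τ + 1)) x‖ ≤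
      ∫ τ in Ioi (0 : ℝ), τ ^ (-α) / (τ + 1) * Real.exp (-(w * t * (τ + 1))) * (M * ‖x‖) := by
    refine norm_integral_le_of_norm_le hbi ?_
    filter_upwards [ae_restrict_mem measurableSet_Ioi] with τ hτ
    have hτ0 : (0 : ℝ) < τ := hτ
    rw [norm_smul, Real.norm_of_nonneg (by positivity), mul_assoc]
    refine mul_le_mul_of_nonneg_left ?_ (by positivity)
    refine ((S _).le_of_opNorm_le (hB.2 _ (by positivity)) x).trans_eq ?_
    rw [mul_assoc w t]; ring
  rw [integral_mul_const] at hn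
  calc _ ≤ Real.sin (Real.pi * α) / Real.pi * _ := mul_le_mul_of_nonneg_left hn hsin
    _ = _ := by ring

/-- The image of the measure `τ^{-α} / (τ + 1) dτ` on the half-line under `τ ↦ t (τ + 1)`. -/
noncomputable def kernelMeasure (α t : ℝ) : Measure ℝ :=
  ((volume.restrict (Ioi 0)).withDensity fun τ => ENNReal.ofReal (τ ^ (-α) / (τ + 1))).map
    fun τ => t * (τ + 1)

theorem measurableEmbedding_affine {t : ℝ} (ht : 0 < t) :
    MeasurableEmbedding fun τ : ℝ => t * (τ + 1) := by
  refine Measurable.measurableEmbedding (by fun_prop) fun a b hab => ?_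
  simpa [ht.ne'] using hab

theorem integral_kernelMeasure {E : Type*} [NormedAddCommGroup E] [NormedSpace ℝ E] {α t : ℝ}
    (ht : 0 < t) (f : ℝ → E) : ∫ r, f r ∂kernelMeasure α t =
      ∫ τ in Ioi (0 : ℝ), (τ ^ (-α) / (τ + 1)) • f (t * (τ + 1)) := by
  rw [kernelMeasure, (measurableEmbedding_affine ht).integral_map,
    integral_withDensity_eq_integral_toReal_smul (by fun_prop)
      (ae_of_all _ fun _ => ENNReal.ofReal_lt_top)]
  refine setIntegral_congr_fun measurableSet_Ioi fun τ hτ => ?_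
  have hτ0 : (0 : ℝ) < τ := hτ
  rw [ENNReal.toReal_ofReal (by positivity)]

theorem integrable_kernelMeasure_iff {E : Type*} [NormedAddCommGroup E] [NormedSpace ℝ E]
    {α t : ℝ} (ht : 0 < t) (f : ℝ → E) : Integrable f (kernelMeasure α t) ↔
      IntegrableOn (fun τ => (τ ^ (-α) / (τ + 1)) • f (t * (τ + 1))) (Ioi 0) := by
  rw [kernelMeasure, (measurableEmbedding_affine ht).integrable_map_iff,
    integrable_withDensity_iff_integrable_smul' (by fun_prop)
      (ae_of_all _ fun _ => ENNReal.ofReal_lt_top)]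
  refine integrable_congr ?_
  filter_upwards [ae_restrict_mem measurableSet_Ioi] with τ hτ
  have hτ0 : (0 : ℝ) < τ := hτ
  simp only [Function.comp]
  rw [ENNReal.toReal_ofReal (by positivity)]

theorem kernelMeasure_Iio {α t : ℝ} (ht : 0 < t) : kernelMeasure α t (Iio 0) = 0 := by
  rw [kernelMeasure, Measure.map_apply (by fun_prop) measurableSet_Iio]
  refine (withDensity_absolutelyContinuous _ _) ?_
  rw [Measure.restrict_apply ((by fun_prop : Measurable fun τ : ℝ => t * (τ + 1))
    measurableSet_Iio)]
  convert measure_empty (μ := (volume : Measure ℝ))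
  refine eq_empty_of_forall_notMem fun τ hτ => ?_
  have hτ1 : t * (τ + 1) < 0 := hτ.1
  have hτ0 : (0 : ℝ) < τ := hτ.2
  have : 0 < t * (τ + 1) := by positivity
  linarith

/-- The representing measure is `kernelMeasure` with the constant density `sin(πα)/π`; the
substitution `r = t(τ+1)` accounts for the scaling by `t`. -/
theorem phillips_incGamma [CompleteSpace X] (hS : IsMeasurableSemigroup S)
    (hB : HasExpBound S M w)
    (hw : 0 ≤ w) {α : ℝ} (h0 : 0 < α) (h1 : α < 1) {t : ℝ} (ht : 0 < t) (x : X) :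
    phillips S (fun z => incGamma α (t * z)) x = (Real.sin (Real.pi * α) / Real.pi) •
      ∫ τ in Ioi (0 : ℝ), (τ ^ (-α) / (τ + 1)) • S (t * (τ + 1)) x := by
  have hint := fun x => integrableOn_kernel_smul hS hB hw h0 h1 ht x
  let T : X →L[ℂ] X := LinearMap.mkContinuous
    { toFun := fun x => (Real.sin (Real.pi * α) / Real.pi) •
        ∫ τ in Ioi (0 : ℝ), (τ ^ (-α) / (τ + 1)) • S (t * (τ + 1)) x
      map_add' := fun x y => by
        simp_rw [map_add, smul_add]
        rw [integral_add (hint x) (hint y), smul_add]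
      map_smul' := fun c x => by
        simp_rw [map_smul, smul_comm _ c, integral_smul]
        rw [smul_comm, RingHom.id_apply] }
    (M * (incGamma α ((w * t : ℝ) : ℂ)).re)
    (fun x => norm_integral_kernel_le hB hw h0 h1 ht x)
  have hi := integrableOn_rpow_neg_div_add_one h0 h1
  have hfin : IsFiniteMeasure (kernelMeasure α t) := by
    have := isFiniteMeasure_withDensity_ofReal hi.hasFiniteIntegral
    rw [kernelMeasure]
    infer_instance
  have hPh : IsPhillips S (fun z => incGamma α (t * z)) T := by
    refine ⟨kernelMeasure α t,
      fun _ => ((Real.sin (Real.pi * α) / Real.pi : ℝ) : ℂ), hfin, kernelMeasure_Iio ht,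
      integrable_const _, fun z hz => ?_, fun x => ⟨?_, ?_⟩⟩
    · change incGamma α (t * z) = _
      rw [integral_mul_const, integral_kernelMeasure ht, incGamma_eq_integral h0 h1
        (by simpa using mul_nonneg ht.le hz), mul_comm]
      congr 1
      refine setIntegral_congr_fun measurableSet_Ioi fun τ _ => ?_
      rw [Complex.real_smul]
      congr 3
      push_cast; ring
    · rw [integrable_kernelMeasure_iff ht]
      refine ((hint x).smul (Real.sin (Real.pi * α) / Real.pi)).congr (ae_of_all _ fun τ => ?_)
      simp only [Pi.smul_apply]
      rw [Complex.coe_smul, smul_comm]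
    · rw [integral_smul, integral_kernelMeasure ht, Complex.coe_smul]
      rfl
  rw [phillips_eq hPh]
  rfl

/-! ### Smoothing estimates for bounded analytic semigroups. -/

/-- In the disc, `|Im z| ≤ t sin φ / 4` and `|z| ≥ 3t/4`, so the sine of the argument is at most
`sin φ / 3` in absolute value. Proportionality of the radius to `t` is what gives the rate `1/t` in
the Cauchy estimate. -/
theorem closedBall_subset_sector {φ : ℝ} (h0 : 0 < φ) (h1 : φ < Real.pi / 2) {t : ℝ}
    (ht : 0 < t) : Metric.closedBall (t : ℂ) (t * (Real.sin φ / 4)) ⊆ sector φ := by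
  intro z hz
  have hs0 : 0 < Real.sin φ := Real.sin_pos_of_pos_of_lt_pi h0 (by linarith)
  have hs1 : Real.sin φ ≤ 1 := Real.sin_le_one φ
  rw [mem_closedBall_iff_norm] at hz
  have hre : |z.re - t| ≤ t * (Real.sin φ / 4) := by
    simpa using (Complex.abs_re_le_norm (z - t)).trans hz
  have him : |z.im| ≤ t * (Real.sin φ / 4) := by
    simpa using (Complex.abs_im_le_norm (z - t)).trans hz
  have hre' : t * (3 / 4) ≤ z.re := by
    have := (abs_le.1 hre).1
    nlinarith
  have hrepos : 0 < z.re := lt_of_lt_of_le (by positivity) hre'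
  have hz0 : z ≠ 0 := by rintro rfl; simp at hrepos
  refine ⟨hz0, ?_⟩
  have hn : t * (3 / 4) ≤ ‖z‖ := hre'.trans (Complex.re_le_norm z)
  have hnpos : 0 < ‖z‖ := norm_pos_iff.2 hz0
  have hq : |z.im / ‖z‖| < Real.sin φ := by
    rw [abs_div, abs_norm, div_lt_iff₀ hnpos]
    nlinarith [mul_le_mul_of_nonneg_left hn hs0.le, mul_pos ht hs0]
  rw [Complex.arg_of_re_nonneg hrepos.le, abs_lt]
  rw [abs_lt] at hq
  have hmem : φ ∈ Ioc (-(Real.pi / 2)) (Real.pi / 2) := ⟨by linarith, h1.le⟩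
  have hmem' : -φ ∈ Ico (-(Real.pi / 2)) (Real.pi / 2) := ⟨by linarith, by linarith⟩
  constructor
  · rw [Real.lt_arcsin_iff_sin_lt' hmem', Real.sin_neg]
    exact hq.1
  · rw [Real.arcsin_lt_iff_lt_sin' hmem]
    exact hq.2

theorem BoundedAnalytic.exists_deriv (h : BoundedAnalytic S) :
    ∃ (C : ℝ) (D : ℝ → X →L[ℂ] X), ∀ t > 0, HasDerivAt S (D t) t ∧ ‖D t‖ ≤ C / t := by
  obtain ⟨φ, h0, h1, T, hT, ⟨C, hC⟩, hTS⟩ := h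
  have hs0 : 0 < Real.sin φ := Real.sin_pos_of_pos_of_lt_pi h0 (by linarith [Real.pi_pos])
  refine ⟨C / (Real.sin φ / 4), fun t => deriv T t, fun t ht => ?_⟩
  have hR : 0 < t * (Real.sin φ / 4) := by positivity
  have hsub := closedBall_subset_sector h0 h1 ht
  constructor
  · have hd : DifferentiableAt ℂ T t :=
      (hT.mono (Metric.ball_subset_closedBall.trans hsub)).differentiableAt
        (Metric.ball_mem_nhds _ hR)
    have h2 := HasDerivAt.scomp t hd.hasDerivAt Complex.ofRealCLM.hasDerivAt
    simp only [Complex.ofRealCLM_apply, Complex.ofReal_one, one_smul] at h2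
    refine h2.congr_of_eventuallyEq ?_
    filter_upwards [Ioi_mem_nhds ht] with r hr
    exact (hTS r hr).symm
  · refine (Complex.norm_deriv_le_of_forall_mem_sphere_norm_le hR (hT.diffContOnCl_ball hsub)
      fun z hz => hC z (hsub (Metric.sphere_subset_closedBall hz))).trans_eq ?_
    rw [div_div, mul_comm t]

theorem semigroup_deriv_apply (hS : IsMeasurableSemigroup S) {D : ℝ → X →L[ℂ] X}
    (hD : ∀ t > 0, HasDerivAt S (D t) t) {σ t : ℝ} (hσ : 0 ≤ σ) (ht : 0 < t) (y : X) :
    S σ (D t y) = D (t + σ) y := by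
  have hDy : ∀ r > 0, HasDerivAt (fun r => S r y) (D r y) r := fun r hr =>
    ((ContinuousLinearMap.apply ℂ X y).restrictScalars ℝ).hasFDerivAt.comp_hasDerivAt r (hD r hr)
  have h1 : HasDerivAt (fun r => S σ (S r y)) (S σ (D t y)) t :=
    ((S σ).restrictScalars ℝ).hasFDerivAt.comp_hasDerivAt t (hDy t ht)
  have h2 : HasDerivAt (fun r => S (r + σ) y) (D (t + σ) y) t :=
    (hDy (t + σ) (by linarith)).comp_add_const t σ
  refine h1.unique (h2.congr_of_eventuallyEq ?_)
  filter_upwards [Ioi_mem_nhds ht] with r hr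
  rw [add_comm, hS.add σ r hσ (le_of_lt hr), ContinuousLinearMap.comp_apply]

theorem HasExpBound.tendsto_zero (hB : HasExpBound S M w) (hw : 0 < w) (y : X) :
    Tendsto (fun t => S t y) atTop (𝓝 0) := by
  have h1 : Tendsto (fun t => M * Real.exp (-(w * t)) * ‖y‖) atTop (𝓝 0) := by
    have : Tendsto (fun t : ℝ => Real.exp (-(w * t))) atTop (𝓝 0) :=
      Real.tendsto_exp_neg_atTop_nhds_zero.comp (tendsto_id.const_mul_atTop hw)
    simpa using (this.const_mul M).mul_const ‖y‖
  refine squeeze_zero_norm' ?_ h1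
  filter_upwards [eventually_ge_atTop 0] with t ht
  exact (S t).le_of_opNorm_le (hB.2 t ht) y

/-- This is `S'(t) = -A S(t)` in inverted form: `S(σ)S'(t)y` is the `σ`-derivative of `S(t+σ)y`,
which tends to zero at infinity. -/
theorem negPow_one_deriv [CompleteSpace X] (hS : IsMeasurableSemigroup S)
    (hB : HasExpBound S M w) (hw : 0 < w) {D : ℝ → X →L[ℂ] X}
    (hD : ∀ t > 0, HasDerivAt S (D t) t) {t : ℝ} (ht : 0 < t) (y : X) :
    negPow S 1 (D t y) = -S t y := by
  have hDy : ∀ r > 0, HasDerivAt (fun r => S r y) (D r y) r := fun r hr =>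
    ((ContinuousLinearMap.apply ℂ X y).restrictScalars ℝ).hasFDerivAt.comp_hasDerivAt r (hD r hr)
  have hder : ∀ σ ∈ Ici (0 : ℝ), HasDerivAt (fun σ => S (t + σ) y) (S σ (D t y)) σ := by
    intro σ hσ
    have hσ' : (0 : ℝ) ≤ σ := hσ
    rw [semigroup_deriv_apply hS hD hσ' ht]
    exact (hDy (t + σ) (by linarith)).comp_const_add t σ
  have hint : IntegrableOn (fun σ => S σ (D t y)) (Ioi 0) := by
    simpa using negPow_integrableOn hS hB hw one_pos (D t y)
  have hlim : Tendsto (fun σ => S (t + σ) y) atTop (𝓝 0) :=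
    (hB.tendsto_zero hw y).comp (tendsto_atTop_add_const_left _ t tendsto_id)
  have h := integral_Ioi_of_hasDerivAt_of_tendsto' hder hint hlim
  rw [negPow, fracInt, if_neg one_ne_zero]
  simpa using h

/-- In the application `E = A S(r)`, and this says `(A S(r))^n = A^n S(nr)`. Only commutation of
`A^{-1}` with the semigroup is needed. -/
theorem negPow_pow [CompleteSpace X] (hS : IsMeasurableSemigroup S)
    (hB : HasExpBound S M w) (hw : 0 < w) {r : ℝ} (hr : 0 ≤ r) {E : X →L[ℂ] X}
    (hE : ∀ y, negPow S 1 (E y) = S r y) (n : ℕ) (y : X) :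
    negPow S n ((E ^ n) y) = S (n * r) y := by
  induction n generalizing y with
  | zero => simp [negPow_zero, hS.zero]
  | succ n ih =>
    have hn : (0 : ℝ) ≤ n := n.cast_nonneg
    have hnr : (0 : ℝ) ≤ n * r := by positivity
    have hpow : (E ^ (n + 1)) y = (E ^ n) (E y) := by rw [pow_succ]; rfl
    rw [hpow, Nat.cast_succ, add_comm, ← negPow_negPow hS hB hw zero_le_one hn, ih,
      ← semigroup_negPow hS hB hw zero_le_one hnr, hE, add_comm, add_mul, one_mul,
      hS.add _ _ hnr hr, ContinuousLinearMap.comp_apply]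

/-- For a bounded analytic semigroup, `S(t) = A^{-n} G(t)` with `‖G(t)‖ ≤ C t^{-n} e^{-w't}`. -/
theorem BoundedAnalytic.exists_natPow [CompleteSpace X] (h : BoundedAnalytic S)
    (hS : IsMeasurableSemigroup S) (hB : HasExpBound S M w) {A : X →ₗ.[ℂ] X}
    (hA : IsNegGenerator A S) {w' : ℝ} (hw' : 0 ≤ w') (hww : w' < w) {n : ℕ} (hn : 0 < n) :
    ∃ (C : ℝ) (G : ℝ → X →L[ℂ] X), ∀ t > 0, (∀ y, negPow S n (G t y) = S t y) ∧
      ‖G t‖ ≤ C * t ^ (-(n : ℝ)) * Real.exp (-(w' * t)) := by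
  have hw : 0 < w := hw'.trans_lt hww
  obtain ⟨C, D, hD⟩ := h.exists_deriv
  have hn' : (0 : ℝ) < n := by exact_mod_cast hn
  set G : ℝ → X →L[ℂ] X := fun t => (-D (t / n)) ^ n with hG
  have hJ : ∀ t > 0, ∀ y, negPow S n (G t y) = S t y := by
    intro t ht y
    have htn : 0 < t / n := by positivity
    have hE : ∀ y, negPow S 1 ((-D (t / n)) y) = S (t / n) y := by
      intro y
      have h1 := negPow_one_deriv hS hB hw (fun r hr => (hD r hr).1) htn (-y)
      rw [map_neg, map_neg, neg_neg] at h1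
      exact h1
    rw [hG, negPow_pow hS hB hw htn.le hE, mul_div_cancel₀ _ hn'.ne']
  have hbd : ∀ t > 0, ‖G t‖ ≤ (C * n) ^ n * t ^ (-(n : ℝ)) := by
    intro t ht
    have htn : 0 < t / n := by positivity
    have h1 := (hD _ htn).2
    rw [← norm_neg] at h1
    refine (norm_pow_le' _ hn).trans ((pow_le_pow_left₀ (norm_nonneg _) h1 n).trans_eq ?_)
    rw [Real.rpow_neg ht.le, Real.rpow_natCast, ← inv_pow, ← mul_pow]
    congr 1
    field_simp
  -- The time is split as `εt + (1-ε)t` with `w(1-ε) = w'`: the first part pays for the singularity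
  -- `t^{-n}` at the cost of `ε^{-n}`, the second supplies the decay `e^{-w't}`.
  set ε : ℝ := (w - w') / w with hε
  have hε0 : 0 < ε := div_pos (sub_pos.2 hww) hw
  have hε1 : 0 ≤ 1 - ε := by
    rw [hε, sub_nonneg, div_le_one hw]; linarith
  have hwε : w * (1 - ε) = w' := by
    rw [hε]; field_simp; ring
  have hM := hB.1
  refine ⟨(C * n) ^ n * ε ^ (-(n : ℝ)) * M, G, fun t ht => ⟨hJ t ht, ?_⟩⟩
  have hεt : 0 < ε * t := by positivity
  have hεt' : 0 ≤ (1 - ε) * t := by positivity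
  have hfac : G t = (G (ε * t)).comp (S ((1 - ε) * t)) := by
    ext y
    apply negPow_injective hS hB hw hA hn'.le
    rw [hJ t ht, ContinuousLinearMap.comp_apply, hJ _ hεt, ← ContinuousLinearMap.comp_apply,
      ← hS.add _ _ hεt.le hεt', ← add_mul, add_sub_cancel, one_mul]
  rw [hfac]
  have hb := hbd _ hεt
  have hs := hB.2 _ hεt'
  rw [← mul_assoc, hwε] at hs
  rw [Real.mul_rpow hε0.le ht.le] at hb
  calc _ ≤ ‖G (ε * t)‖ * ‖S ((1 - ε) * t)‖ := ContinuousLinearMap.opNorm_comp_le _ _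
    _ ≤ ((C * n) ^ n * (ε ^ (-(n : ℝ)) * t ^ (-(n : ℝ)))) * (M * Real.exp (-(w' * t))) :=
      mul_le_mul hb hs (norm_nonneg _) ((norm_nonneg _).trans hb)
    _ = _ := by ring

theorem integrableOn_rpow_mul_one_add_rpow {α : ℝ} {β : ℝ} (hα : 0 < α) (hβ : 0 < β) :
    IntegrableOn (fun ρ : ℝ => ρ ^ (α - 1) * (1 + ρ) ^ (-(α + β))) (Ioi 0) := by
  have hm : Measurable fun ρ : ℝ => ρ ^ (α - 1) * (1 + ρ) ^ (-(α + β)) := by fun_prop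
  have hnn : ∀ ρ : ℝ, 0 < ρ → 0 ≤ ρ ^ (α - 1) * (1 + ρ) ^ (-(α + β)) := fun ρ hρ => by positivity
  rw [← Ioc_union_Ioi_eq_Ioi (zero_le_one' ℝ)]
  refine IntegrableOn.union ?_ ?_
  · have h : IntegrableOn (fun ρ : ℝ => ρ ^ (α - 1)) (Ioc 0 1) :=
      (intervalIntegrable_iff_integrableOn_Ioc_of_le zero_le_one).1
        (intervalIntegral.intervalIntegrable_rpow' (by linarith))
    refine h.mono' hm.aestronglyMeasurable ?_
    filter_upwards [ae_restrict_mem measurableSet_Ioc] with ρ hρ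
    rw [Real.norm_of_nonneg (hnn ρ hρ.1)]
    exact mul_le_of_le_one_right (Real.rpow_nonneg hρ.1.le _)
      (Real.rpow_le_one_of_one_le_of_nonpos (by linarith [hρ.1]) (by linarith))
  · refine (integrableOn_Ioi_rpow_of_lt (a := -β - 1) (by linarith) one_pos).mono'
      hm.aestronglyMeasurable ?_
    filter_upwards [ae_restrict_mem measurableSet_Ioi] with ρ hρ
    have hρ0 : (0 : ℝ) < ρ := one_pos.trans hρ
    rw [Real.norm_of_nonneg (hnn ρ hρ0), show -β - 1 = (α - 1) + -(α + β) by ring,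
      Real.rpow_add hρ0]
    exact mul_le_mul_of_nonneg_left
      (Real.rpow_le_rpow_of_nonpos hρ0 (by linarith) (by linarith)) (by positivity)

/-- The substitution `σ = tρ`, which extracts the factor `t^{-β}` of the analytic estimate. -/
theorem integral_rpow_mul_add_rpow {α β t : ℝ} (hα : 0 < α) (hβ : 0 < β) (ht : 0 < t) :
    IntegrableOn (fun σ : ℝ => σ ^ (α - 1) * (t + σ) ^ (-(α + β))) (Ioi 0) ∧
    ∫ σ in Ioi (0 : ℝ), σ ^ (α - 1) * (t + σ) ^ (-(α + β)) =
      t ^ (-β) * ∫ ρ in Ioi (0 : ℝ), ρ ^ (α - 1) * (1 + ρ) ^ (-(α + β)) := by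
  have hsub : ∀ ρ ∈ Ioi (0 : ℝ), t ^ (-β - 1) * (ρ ^ (α - 1) * (1 + ρ) ^ (-(α + β))) =
      (t * ρ) ^ (α - 1) * (t + t * ρ) ^ (-(α + β)) := by
    intro ρ hρ
    have hρ0 : (0 : ℝ) < ρ := hρ
    rw [show t + t * ρ = t * (1 + ρ) by ring, Real.mul_rpow ht.le hρ0.le,
      Real.mul_rpow ht.le (by positivity), show -β - 1 = (α - 1) + -(α + β) by ring,
      Real.rpow_add ht]
    ring
  constructor
  · have h := integrableOn_Ioi_comp_mul_left_iff
      (fun σ : ℝ => σ ^ (α - 1) * (t + σ) ^ (-(α + β))) 0 ht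
    rw [mul_zero] at h
    exact h.1 (IntegrableOn.congr_fun (Integrable.const_mul
      (integrableOn_rpow_mul_one_add_rpow hα hβ) (t ^ (-β - 1))) hsub measurableSet_Ioi)
  · have h := integral_comp_mul_left_Ioi
      (fun σ : ℝ => σ ^ (α - 1) * (t + σ) ^ (-(α + β))) 0 ht
    rw [mul_zero, ← setIntegral_congr_fun measurableSet_Ioi hsub, integral_const_mul,
      Real.rpow_sub_one ht.ne', smul_eq_mul] at h
    field_simp at h
    exact h.symm

theorem BoundedAnalytic.exists_hasAnalyticBound [CompleteSpace X] (h : BoundedAnalytic S)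
    (hS : IsMeasurableSemigroup S) (hB : HasExpBound S M w) {A : X →ₗ.[ℂ] X}
    (hA : IsNegGenerator A S) {w' : ℝ} (hw' : 0 ≤ w') (hww : w' < w) {β : ℝ} (hβ : 0 ≤ β) :
    ∃ K : ℝ, HasAnalyticBound S β K w' := by
  have hw : 0 < w := hw'.trans_lt hww
  have hM := hB.1
  rcases hβ.eq_or_lt with rfl | hβ
  -- The case `β = 0` is separate because the integral used below then diverges at infinity.
  · refine ⟨M, hM, fun t ht x => ⟨fracPow_zero_domain S _, ?_⟩⟩
    rw [fracPowApply_zero, neg_zero, Real.rpow_zero, mul_one]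
    refine (S t).le_of_opNorm_le ((hB.2 t ht.le).trans ?_) x
    gcongr
  -- Strictly larger than `β`, even for integer `β`, so that `α = n - β > 0` and `A^{-α}` is given
  -- by its integral.
  set n : ℕ := ⌊β⌋₊ + 1 with hn
  have hα : 0 < (n : ℝ) - β := by
    rw [hn, sub_pos]; push_cast; exact Nat.lt_floor_add_one β
  set α : ℝ := (n : ℝ) - β with hα'
  have hαβ : α + β = n := by rw [hα', sub_add_cancel]
  obtain ⟨C, G, hG⟩ := h.exists_natPow hS hB hA hw' hww (n := n) (Nat.succ_pos _)
  have hn0 : (0 : ℝ) ≤ n := n.cast_nonneg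
  set I : ℝ := ∫ ρ in Ioi (0 : ℝ), ρ ^ (α - 1) * (1 + ρ) ^ (-(α + β)) with hI
  have hC : 0 ≤ C := by
    have := (norm_nonneg _).trans (hG 1 one_pos).2
    rw [Real.one_rpow, mul_one] at this
    exact nonneg_of_mul_nonneg_left this (Real.exp_pos _)
  have hΓ := Real.Gamma_pos_of_pos hα
  refine ⟨max 1 ((Real.Gamma α)⁻¹ * C * I), le_max_left _ _, fun t ht x => ?_⟩
  have heq : S t x = negPow S β (negPow S α (G t x)) := by
    rw [negPow_negPow hS hB hw hβ.le hα.le, add_comm, hαβ, (hG t ht).1]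
  rw [heq]
  refine ⟨negPow_mem_fracPow_domain hS hB hw hβ.le _, ?_⟩
  rw [fracPowApply_negPow hS hB hw hA hβ.le, negPow, fracInt, if_neg hα.ne', norm_smul,
    Real.norm_of_nonneg (inv_pos.2 hΓ).le]
  -- With `G(t) = A^n S(t)`, this turns `A^β S(t) = A^{-α} G(t)` into an integral of `σ^{α-1}
  -- G(t+σ)`, to which the bound on `G` applies.
  have hSG : ∀ σ > 0, S σ (G t x) = G (t + σ) x := by
    intro σ hσ
    apply negPow_injective hS hB hw hA hn0
    rw [← semigroup_negPow hS hB hw hn0 (le_of_lt hσ), (hG t ht).1, (hG _ (by linarith)).1,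
      add_comm, hS.add σ t (le_of_lt hσ) ht.le, ContinuousLinearMap.comp_apply]
  obtain ⟨hint, hval⟩ := integral_rpow_mul_add_rpow hα hβ ht
  have hle : ‖∫ σ in Ioi (0 : ℝ), σ ^ (α - 1) • S σ (G t x)‖ ≤
      ∫ σ in Ioi (0 : ℝ), σ ^ (α - 1) * (t + σ) ^ (-(α + β)) *
        (C * Real.exp (-(w' * t)) * ‖x‖) := by
    refine norm_integral_le_of_norm_le (hint.mul_const _) ?_
    filter_upwards [ae_restrict_mem measurableSet_Ioi] with σ hσ
    have hσ0 : (0 : ℝ) < σ := hσ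
    have htσ : 0 < t + σ := by linarith
    rw [norm_smul, Real.norm_of_nonneg (by positivity), mul_assoc, hSG σ hσ0, hαβ]
    refine mul_le_mul_of_nonneg_left ?_ (by positivity)
    refine ((G _).le_of_opNorm_le (hG _ htσ).2 x).trans ?_
    have hexp : Real.exp (-(w' * (t + σ))) ≤ Real.exp (-(w' * t)) := by
      rw [Real.exp_le_exp]; nlinarith
    calc C * (t + σ) ^ (-(n : ℝ)) * Real.exp (-(w' * (t + σ))) * ‖x‖
        ≤ C * (t + σ) ^ (-(n : ℝ)) * Real.exp (-(w' * t)) * ‖x‖ := by gcongr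
      _ = _ := by ring
  rw [integral_mul_const, hval, ← hI] at hle
  calc (Real.Gamma α)⁻¹ * ‖∫ σ in Ioi (0 : ℝ), σ ^ (α - 1) • S σ (G t x)‖
      ≤ (Real.Gamma α)⁻¹ * (t ^ (-β) * I * (C * Real.exp (-(w' * t)) * ‖x‖)) := by gcongr
    _ = ((Real.Gamma α)⁻¹ * C * I) * t ^ (-β) * Real.exp (-(w' * t)) * ‖x‖ := by ring
    _ ≤ _ := by
      gcongr
      exact le_max_right _ _

/-! ### Constant data and the final assembly. -/

theorem halfCb_const {X : Type*} [NormedAddCommGroup X] (t₀ : ℝ) (c : X) :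
    HalfCb t₀ fun _ => c :=
  ⟨continuousOn_const, ‖c‖, fun _ _ => le_rfl⟩

theorem fract_pos_of_ne_nat {s : ℝ} (hs : 0 < s) (hsN : ∀ n : ℕ, s ≠ n) : 0 < Int.fract s := by
  refine (Int.fract_nonneg s).lt_of_ne fun h => hsN ⌊s⌋₊ ?_
  have h1 := Int.self_sub_floor s
  rw [← h, sub_eq_zero, ← natCast_floor_eq_intCast_floor hs.le] at h1
  exact h1

/-- The fractional derivatives of a constant datum `x ∈ D(A^{(s-1) ∨ 0})` are the constants
`A^{{s}+k-1} x`. -/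
theorem exists_const_fracDeriv [CompleteSpace X] {A : X →ₗ.[ℂ] X}
    (hS : IsMeasurableSemigroup S) (hA : IsNegGenerator A S) {s : ℝ} (hs : 0 < s) (t₀ : ℝ) {x : X}
    (hx : x ∈ (fracPow S (max (s - 1) 0)).domain) (hcase : s < 1 ∨ UniformlyExpStable S) :
    (∀ F : (ℝ → X) → Prop, (∀ c : X, F fun _ => c) → ∃ c : X,
      IsFracDeriv A S F t₀ (max (s - 1) 0) (fun _ => x) fun _ => c) ∧
    ∃ Y : ℕ → X, ∀ k ∈ Finset.Icc 1 ⌊s⌋₊,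
      (∀ F : (ℝ → X) → Prop, (∀ c : X, F fun _ => c) →
        IsFracDeriv A S F t₀ (Int.fract s + k - 1) (fun _ => x) fun _ => Y k) ∧
      (∀ F : (ℝ → X) → Prop, (∀ u, F u → ∀ a, IntegrableOn u (Icc a t₀)) → ∀ D : ℝ → X,
        IsFracDeriv A S F t₀ (Int.fract s + k - 1) (fun _ => x) D → ContinuousOn D (Iic t₀) →
        D t₀ = Y k) ∧
      ∀ t, 0 ≤ t → S t x ∈ (fracPow S (Int.fract s + k - 1)).domain ∧
        fracPowApply S (Int.fract s + k - 1) (S t x) = S t (Y k) := by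
  rcases lt_or_ge s 1 with h1 | h1
  · have hmax : max (s - 1) 0 = 0 := max_eq_right (by linarith)
    have hfl : ⌊s⌋₊ = 0 := Nat.floor_eq_zero.2 h1
    exact ⟨fun F hF => ⟨x, by rw [hmax]; exact isFracDeriv_zero A S t₀ (hF x)⟩, fun _ => 0,
      fun k hk => by rw [hfl, Finset.mem_Icc] at hk; omega⟩
  obtain ⟨M, w, hw, hB⟩ := hcase.resolve_left (not_lt.2 h1)
  have hs1 : 0 ≤ s - 1 := by linarith
  rw [max_eq_left hs1] at hx ⊢
  obtain ⟨y, rfl⟩ := (mem_fracPow_domain hS hB hw hs1 x).1 hx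
  refine ⟨fun F hF => ⟨y, isFracDeriv_const hS hB hw hA hF t₀ hs1 y⟩,
    -- With `x = A^{-(s-1)}y`, this is `A^{{s}+k-1}x`; the exponent equals `⌊s⌋ - k`, nonnegative on
    -- the range of summation.
    fun k => negPow S (s - 1 - (Int.fract s + k - 1)) y, fun k hk => ?_⟩
  rw [Finset.mem_Icc] at hk
  have hk1 : (1 : ℝ) ≤ k := by exact_mod_cast hk.1
  have hk2 : (k : ℝ) ≤ ⌊s⌋₊ := by exact_mod_cast hk.2
  have hβ : 0 ≤ Int.fract s + k - 1 := by linarith [Int.fract_nonneg s]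
  have hd : 0 ≤ s - 1 - (Int.fract s + k - 1) := by
    have := Int.floor_add_fract s
    rw [← natCast_floor_eq_intCast_floor hs.le] at this
    linarith
  have heq : negPow S (s - 1) y = negPow S (Int.fract s + k - 1)
      (negPow S (s - 1 - (Int.fract s + k - 1)) y) := by
    rw [negPow_negPow hS hB hw hβ hd, add_sub_cancel]
  rw [heq]
  refine ⟨fun F hF => isFracDeriv_const hS hB hw hA hF t₀ hβ _, fun F hF D hD hc =>
    eq_of_ae_eq_const hc (hD.ae_eq_of_const hS hB hw hA hF hβ), fun t ht => ?_⟩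
  rw [semigroup_negPow hS hB hw hβ ht]
  exact ⟨negPow_mem_fracPow_domain hS hB hw hβ _, fracPowApply_negPow hS hB hw hA hβ _⟩

end FracParabolic

theorem corollary3p4 {X : Type*} [NormedAddCommGroup X] [NormedSpace ℂ X] [CompleteSpace X]
    (A : X →ₗ.[ℂ] X) (S : ℝ → X →L[ℂ] X)
    (hS : FracParabolic.IsMeasurableSemigroup S)
    (hbdd : FracParabolic.UniformlyBounded S)
    (hA : FracParabolic.IsNegGenerator A S)
    (s : ℝ) (hs : 0 < s) (hsN : ∀ n : ℕ, s ≠ n)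
    (p : ℝ≥0∞) (hp : 1 ≤ p) (t₀ : ℝ)
    (x : X) (hx : x ∈ (FracParabolic.fracPow S (max (s - 1) 0)).domain)
    (hcase : s < 1 ∨ FracParabolic.UniformlyExpStable S) :
    -- the constant datum is admissible, so that the solution exists
    (p = ⊤ → ∃ u : ℝ → X, FracParabolic.IsDirichletSolution A S
      (FracParabolic.HalfLp p t₀) s t₀ (fun _ => x) u) ∧
    (∃ u : ℝ → X, FracParabolic.IsDirichletSolution A S
      (FracParabolic.HalfLpLoc p t₀) s t₀ (fun _ => x) u) ∧
    (∀ F : (ℝ → X) → Prop,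
      (F = FracParabolic.HalfLp p t₀ ∨ F = FracParabolic.HalfLpLoc p t₀) →
      ∀ u : ℝ → X, FracParabolic.IsDirichletSolution A S F s t₀ (fun _ => x) u →
        -- the formula; all powers occurring in it are applied to elements of their domains
        (∀ t : ℝ, t₀ < t →
          (∀ k ∈ Finset.Icc 1 ⌊s⌋₊,
            S (t - t₀) x ∈ (FracParabolic.fracPow S ((k : ℝ) + Int.fract s - 1)).domain) ∧
          u t = FracParabolic.incGammaOp S s (t - t₀) x) ∧
        -- the norm bound
        (s < 1 ∨ FracParabolic.BoundedAnalytic S →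
          ∀ M₀ w : ℝ, 0 ≤ w → FracParabolic.HasExpBound S M₀ w →
          ∀ M : ℝ → ℝ,
            (∀ k ∈ Finset.Icc 1 ⌊s⌋₊, FracParabolic.HasAnalyticBound S
              (Int.fract s + k - 1) (M (Int.fract s + k - 1)) w) →
            ∀ t : ℝ, t₀ < t →
              ‖u t‖ ≤
                (M₀ * (FracParabolic.incGamma (Int.fract s) ((w * (t - t₀) : ℝ) : ℂ)).re +
                  Real.exp (-(w * (t - t₀))) *
                    ∑ k ∈ Finset.Icc 1 ⌊s⌋₊,
                      M (Int.fract s + k - 1) / Real.Gamma (Int.fract s + k)) * ‖x‖)) ∧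
    -- existence of the constants of the analytic estimate
    (FracParabolic.UniformlyExpStable S → FracParabolic.BoundedAnalytic S →
      ∀ M₀ w : ℝ, FracParabolic.HasExpBound S M₀ w →
      ∀ w' : ℝ, 0 ≤ w' → w' < w → ∀ β : ℝ, 0 ≤ β →
        ∃ M : ℝ, FracParabolic.HasAnalyticBound S β M w') := by
  obtain ⟨M₁, w₁, hw₁, hB₁⟩ := hbdd
  have hθ0 : 0 < Int.fract s := FracParabolic.fract_pos_of_ne_nat hs hsN
  have hθ1 : Int.fract s < 1 := Int.fract_lt_one s
  obtain ⟨hdom, Y, hY⟩ := FracParabolic.exists_const_fracDeriv hS hA hs t₀ hx hcase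
  -- Existence only requires that `F` contain the constants, which holds for every local space and,
  -- on the unbounded half-line, for `p = ∞`.
  have hexists : ∀ F : (ℝ → X) → Prop, (∀ c : X, F fun _ => c) →
      ∃ u : ℝ → X, FracParabolic.IsDirichletSolution A S F s t₀ (fun _ => x) u := by
    intro F hF
    obtain ⟨c, hc⟩ := hdom F hF
    refine ⟨fun t => if t ≤ t₀ then x else
      (Real.sin (Real.pi * Int.fract s) / Real.pi) •
          (∫ τ in Ioi (0 : ℝ), (τ ^ (-Int.fract s) / (τ + 1)) • S ((t - t₀) * (τ + 1)) x) +
        ∑ k ∈ Finset.Icc 1 ⌊s⌋₊,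
          ((t - t₀) ^ (Int.fract s + k - 1) / Real.Gamma (Int.fract s + k)) • S (t - t₀) (Y k),
      FracParabolic.halfCb_const t₀ x, ⟨_, hc, FracParabolic.halfCb_const t₀ c⟩,
      fun t ht => if_pos ht, fun k _ => Y k,
      fun k hk => ⟨(hY k hk).1 F hF, continuousOn_const⟩, fun t ht => ⟨?_, if_neg (not_le.2 ht)⟩⟩
    exact FracParabolic.integrableOn_kernel_smul hS hB₁ hw₁ hθ0 hθ1 (sub_pos.2 ht) x
  refine ⟨fun hp' => hexists _ fun c => ?_, hexists _ fun c a => memLp_const c,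
    fun F hF u hu => ?_, fun _ han M₀ w hB w' hw' hww β hβ =>
      han.exists_hasAnalyticBound hS hB hA hw' hww hβ⟩
  · rw [hp']
    exact memLp_top_const c
  obtain ⟨D, hD, hform⟩ := hu.eq_formula
  -- The derivatives `D` come with the given solution and are arbitrary; uniqueness and continuity
  -- pin down their values at `t₀`.
  have hD0 : ∀ k ∈ Finset.Icc 1 ⌊s⌋₊, D k t₀ = Y k := fun k hk =>
    (hY k hk).2.1 F (fun v hv a => FracParabolic.integrableOn_of_halfLp hp hF hv a) _
      (hD k hk).1 (hD k hk).2
  have hu_eq : ∀ t, t₀ < t → u t = (Real.sin (Real.pi * Int.fract s) / Real.pi) •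
        (∫ τ in Ioi (0 : ℝ), (τ ^ (-Int.fract s) / (τ + 1)) • S ((t - t₀) * (τ + 1)) x) +
      ∑ k ∈ Finset.Icc 1 ⌊s⌋₊,
        ((t - t₀) ^ (Int.fract s + k - 1) / Real.Gamma (Int.fract s + k)) •
          FracParabolic.fracPowApply S (Int.fract s + k - 1) (S (t - t₀) x) := by
    intro t ht
    rw [(hform t ht).2]
    congr 1
    refine Finset.sum_congr rfl fun k hk => ?_
    rw [hD0 k hk, ((hY k hk).2.2 _ (sub_pos.2 ht).le).2]
  refine ⟨fun t ht => ⟨fun k hk => ?_, ?_⟩, fun _ M₀ w hw hB M hM t ht => ?_⟩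
  · rw [add_comm (k : ℝ)]
    exact ((hY k hk).2.2 _ (sub_pos.2 ht).le).1
  · rw [hu_eq t ht, FracParabolic.incGammaOp,
      FracParabolic.phillips_incGamma hS hB₁ hw₁ hθ0 hθ1 (sub_pos.2 ht)]
    congr 1
    refine Finset.sum_congr rfl fun k _ => ?_
    rw [add_comm (k : ℝ)]
  · have ht' : 0 < t - t₀ := sub_pos.2 ht
    rw [hu_eq t ht, add_mul, mul_assoc, mul_assoc, Finset.sum_mul, Finset.mul_sum, ← mul_assoc]
    refine (norm_add_le _ _).trans (add_le_add
      (FracParabolic.norm_integral_kernel_le hB hw hθ0 hθ1 ht' x) ?_)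
    refine (norm_sum_le _ _).trans (Finset.sum_le_sum fun k hk => ?_)
    have hΓ : 0 < Real.Gamma (Int.fract s + k) := Real.Gamma_pos_of_pos (by positivity)
    have hb := ((hM k hk).2 _ ht' x).2
    rw [norm_smul, Real.norm_of_nonneg (by positivity)]
    have hpow : (t - t₀) ^ (Int.fract s + k - 1) * (t - t₀) ^ (-(Int.fract s + k - 1)) = 1 := by
      rw [← Real.rpow_add ht', add_neg_cancel, Real.rpow_zero]
    calc _ ≤ (t - t₀) ^ (Int.fract s + k - 1) / Real.Gamma (Int.fract s + k) *
          (M (Int.fract s + k - 1) * (t - t₀) ^ (-(Int.fract s + k - 1)) *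
            Real.exp (-(w * (t - t₀))) * ‖x‖) := by gcongr
      _ = ((t - t₀) ^ (Int.fract s + k - 1) * (t - t₀) ^ (-(Int.fract s + k - 1))) *
          (Real.exp (-(w * (t - t₀))) *
            (M (Int.fract s + k - 1) / Real.Gamma (Int.fract s + k) * ‖x‖)) := by ring
      _ = _ := by rw [hpow, one_mul]
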